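/- Consider the Brockett integrator $\dot x_1=u_1,\ \dot x_2=u_2,\ \dot x_3=x_1u_2-x_2u_1$ on $\mathbb R^3$. Write $\sigma(x)=\sqrt{x_1^2+x_2^2}$, let $Q(x)=(\sigma(x)-|x_3|)^2+x_3^2$, and let $C=\{x:\sigma(x)=0,\ x_3\ne0\}$ be the $x_3$-axis without the origin. For $\sigma(x)\neq0$, $x_3\ne 0$ let $G(x)=\nabla_u\omega(x,u)\in\mathbb R^2$ be the vector with components $$G_1=2x_1-4x_2x_3-\tfrac{2|x_3|x_1}{\sigma(x)}+2\,\mathrm{sign}(x_3)\,x_2\,\sigma(x),\qquad G_2=2x_2+4x_1x_3-\tfrac{2|x_3|x_2}{\sigma(x)}-2\,\mathrm{sign}(x_3)\,x_1\,\sigma(x),$$ i.e. the gradient in $u$ of the derivative $\omega(x,u)$ of $Q$ along the system. Let $v(x_3)\in\mathbb R^2$, $x_3\neq0$, be arbitrary unit vectors. For $\gamma>0$ define the feedback $$u(x)=\begin{cases}0,&x=0,\\-\gamma\,\sigma(x)^{-1}(x_1,x_2),&x_3=0,\ \sigma(x)\ne0,\\ \gamma\,v(x_3),&\sigma(x)=0,\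 x_3\neq0,\\-\gamma\,|G(x)|^{-1}G(x),&\sigma(x)\ne0,\ x_3\ne0.\end{cases}$$ A solution on $[0,\infty)$ of the closed-loop system is a locally absolutely continuous function satisfying it for almost every $t\ge0$; a classical solution on a set of times is a continuously differentiable function satisfying it at every time of the set. Then, for every $\gamma>0$: 1. $u(0)=0$ and $|u(x)|=\gamma$ for all $x\neq0$. In particular, for every $\varepsilon>0$ the choice $\gamma=\sqrt\varepsilon$ gives $u_1(x)^2+u_2(x)^2\le\varepsilon$ for all $x$. 2. For every $x_0\notin C$ (in particular for every $x_0$ not on the $x_3$-axis), every solution $x(t)$ on $[0,\infty)$ with $x(0)=x_0$ satisfies $x(t)\notin C$ for all $t\ge0$, is bounded, and $Q(x(t))\to0$ and $x(t)\to0$ as $t\to\infty$. 3. For every $x_0\notin C$ there are $t_0\in(0,+\infty]$ and a solution $x(t)$ on $[0,\infty)$ with $x(0)=x_0$ that is a classical solution on $[0,\infty)\setminus\{t_0\}$. If $x_0\ne0$, then $x(t)\neq0$ for $0\le t<t_0$. If $t_0<\infty$, then $x(t)\to0$ as $t\uparrow t_0$ and $x(t)=0$ for $t\ge t_0$. As long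 as $x(t)\neq0$, the control does not switch (that is, $\sigma(x(t))\neq0$, and $x_3(t)=0$ if and only if $x_3(0)=0$), and $t\mapsto u(x(t))$ is continuous on $\{t\ge0:x(t)\ne0\}$. 4. The solution $x(t)$ in 3 is the unique maximal classical solution: any classical solution $y$ on $[0,\tau)$, $\tau\le+\infty$, with $y(0)=x_0$ has $\tau\le t_0$ and coincides with $x$ on $[0,\tau)$. If the third coordinate of $x_0$ is nonzero, $x$ is moreover the only absolutely continuous solution on $[0,\infty)$ starting at $x_0$. -/

import Mathlib

open Set Filter Topology MeasureTheory

noncomputable section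

namespace Brockett

/-- The state space `ℝ³`; the coordinates `x₁, x₂, x₃` are `x 0, x 1, x 2`. -/
abbrev State : Type := EuclideanSpace ℝ (Fin 3)

/-- The control space `ℝ²`; the components `u₁, u₂` are `u 0, u 1`. -/
abbrev Control : Type := EuclideanSpace ℝ (Fin 2)

/-- Right-hand side of the Brockett integrator
`ẋ₁ = u₁, ẋ₂ = u₂, ẋ₃ = x₁ u₂ - x₂ u₁`. -/
def field (x : State) (u : Control) : State :=
  !₂[u 0, u 1, x 0 * u 1 - x 1 * u 0]

/-- `σ(x) = √(x₁² + x₂²)`. -/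
def sigma (x : State) : ℝ := Real.sqrt (x 0 ^ 2 + x 1 ^ 2)

/-- The goal function `Q(x) = (√(x₁² + x₂²) - |x₃|)² + x₃²`. -/
def Q (x : State) : ℝ := (sigma x - |x 2|) ^ 2 + x 2 ^ 2

/-- The exceptional set `C`: the `x₃`-axis without the origin. -/
def exceptional : Set State := {x | sigma x = 0 ∧ x 2 ≠ 0}

/-- The speed `ω(x, u)` of `Q` along the system, for `σ(x) ≠ 0` and `x₃ ≠ 0`
(see `hasFDerivAt_Q` below). -/
def omega (x : State) (u : Control) : ℝ :=
  2 * x 0 * u 0 + 2 * x 1 * u 1 + 4 * x 2 * (x 0 * u 1 - x 1 * u 0)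
    - 2 * |x 2| * (x 0 * u 0 + x 1 * u 1) / sigma x
    - 2 * Real.sign (x 2) * sigma x * (x 0 * u 1 - x 1 * u 0)

/-- The gradient of `u ↦ ω(x, u)`, for `σ(x) ≠ 0` and `x₃ ≠ 0`
(see `hasGradientAt_omega` below). -/
def gradOmega (x : State) : Control :=
  !₂[2 * x 0 - 4 * x 1 * x 2 - 2 * (|x 2| * x 0 / sigma x)
        + 2 * Real.sign (x 2) * x 1 * sigma x,
     2 * x 1 + 4 * x 0 * x 2 - 2 * (|x 2| * x 1 / sigma x)
        - 2 * Real.sign (x 2) * x 0 * sigma x]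

open Classical in
/-- The speed-gradient feedback with gain `γ` and selection `v = v(x₃)`. -/
def feedback (γ : ℝ) (v : ℝ → Control) (x : State) : Control :=
  if x = 0 then 0
  else if x 2 = 0 then (-γ * (sigma x)⁻¹) • !₂[x 0, x 1]
  else if sigma x = 0 then γ • v (x 2)
  else (-γ * ‖gradOmega x‖⁻¹) • gradOmega x

/-- Right-hand side of the closed-loop system. -/
def closedLoop (γ : ℝ) (v : ℝ → Control) (x : State) : State :=
  field x (feedback γ v x)

/-- Solutions of `ẋ = f(x)` on `[0, ∞)` for a possibly discontinuous `f`: absolutely continuous on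
every `[0, T]`, with the equation holding for almost every `t ≥ 0`. -/
def IsSolution (f : State → State) (x : ℝ → State) : Prop :=
  (∀ T : ℝ, 0 ≤ T → AbsolutelyContinuousOnInterval x 0 T) ∧
    ∀ᵐ t : ℝ, 0 ≤ t → HasDerivAt x (f (x t)) t

/-- Classical solutions of `ẋ = f(x)` on a set `I` of times: the equation holds at every `t ∈ I`
(with a one-sided derivative at an end point) and the derivative is continuous on `I`. -/
def IsClassicalSolutionOn (f : State → State) (x : ℝ → State) (I : Set ℝ) : Prop :=
  (∀ t ∈ I, HasDerivWithinAt x (f (x t)) I t) ∧ ContinuousOn (fun t => f (x t)) I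

/-- The time interval `[0, τ)`, where `τ` may be `+∞`. -/
def timeInterval (τ : EReal) : Set ℝ := {t | 0 ≤ t ∧ (t : EReal) < τ}

theorem hasGradientAt_omega (x : State) (u : Control) :
    HasGradientAt (omega x) (gradOmega x) u := by
  have h : omega x = fun w => InnerProductSpace.toDual ℝ Control (gradOmega x) w := by
    funext w
    simp [omega, gradOmega, PiLp.inner_apply, Fin.sum_univ_two]
    ring
  unfold HasGradientAt
  rw [h]
  exact ((InnerProductSpace.toDual ℝ Control (gradOmega x)) : Control →L[ℝ] ℝ).hasFDerivAt

theorem hasFDerivAt_Q (x : State) (hs : sigma x ≠ 0) (h3 : x 2 ≠ 0) :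
    ∃ Q' : State →L[ℝ] ℝ, HasFDerivAt Q Q' x ∧ ∀ u, Q' (field x u) = omega x u := by
  have hp (i : Fin 3) : HasFDerivAt (fun y : State => y i)
      (EuclideanSpace.proj i : State →L[ℝ] ℝ) x :=
    (EuclideanSpace.proj i : State →L[ℝ] ℝ).hasFDerivAt
  have hpos : x 0 ^ 2 + x 1 ^ 2 ≠ 0 := by
    intro h
    exact hs (by simp [sigma, h])
  have h1 := (((hp 0).pow 2).add ((hp 1).pow 2)).sqrt hpos
  have h2 := (hasDerivAt_abs h3).comp_hasFDerivAt x (hp 2)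
  have h4 := ((h1.sub h2).pow 2).add ((hp 2).pow 2)
  refine ⟨_, h4, fun u => ?_⟩
  have hsq : sigma x ^ 2 = x 0 ^ 2 + x 1 ^ 2 := Real.sq_sqrt (by positivity)
  have hsd : Real.sqrt (x 0 ^ 2 + x 1 ^ 2) = sigma x := rfl
  rcases lt_or_gt_of_ne h3 with h | h
  · simp [omega, field, hsd, abs_of_neg h, Real.sign_of_neg h, sign_neg h]
    field_simp
    ring
  · simp [omega, field, hsd, abs_of_pos h, Real.sign_of_pos h, sign_pos h]
    field_simp
    ring

end Brockett

end

noncomputable section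

namespace Brockett

/-! Write `w = |x₃|`. Divided by `σ`, the products `x · G` and `x × G` are the radial component `2(σ
- w)` and the angular component `2 sign(x₃) σ(2w - σ)` of the speed gradient. Hence `|G|² = 4((σ -
w)² + σ²(2w - σ)²)` on `regular`, and the bracket vanishes only at the origin. Along solutions in
`regular`, `Q` decreases at rate `γ|G|`, which is bounded below on each shell `ε ≤ Q ≤ R`; so `Q →
0`, and `|x|² ≤ 3Q` gives `x → 0`.

Two differential inequalities keep solutions in `regular`. First, `x₃ẋ₃ ≥ -2γx₃²`, so `x₃` decays at
most exponentially (`IsTraj.vertical_sq_ge`). Second, `σ` does not decrease while `σ < w`, so it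
cannot fall below a lower bound for `w` that it satisfied initially (`IsTraj.le_sigma`). Both
survive multiplication of the field by a factor in `[0, 1]`, hence also hold for a cut-off, globally
Lipschitz field; they confine its trajectories to a compact set where nothing was cut off. This
gives global existence, and the same cut-off gives uniqueness.

The exceptional set is never entered, even from the plane or the origin: just before entry `σ` would
be nondecreasing with final value `0`, hence identically `0`, contradicting `|u| = γ`.

An absolutely continuous solution either stays in the plane `x₃ = 0`, where `σ² = Q` decays
directly, or is in `regular` from some time on. Classical solutions are more rigid: `|u|` takes only
the values `0` and `γ`, so continuity forbids reaching or leaving the origin, and `ẋ₃` would have to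
jump on leaving the plane elsewhere. In the plane the motion is radial with speed `γ` and ends at
time `σ(x₀)/γ`. -/

/-- The set on which the closed-loop vector field is smooth. -/
def regular : Set State := {x | sigma x ≠ 0 ∧ x 2 ≠ 0}

/-! ### Elementary facts on `σ`, `Q` and the speed gradient -/

theorem sigma_nonneg (x : State) : 0 ≤ sigma x := Real.sqrt_nonneg _

theorem sigma_sq (x : State) : sigma x ^ 2 = x 0 ^ 2 + x 1 ^ 2 := Real.sq_sqrt (by positivity)

theorem continuous_sigma : Continuous sigma := by
  unfold sigma; fun_prop

theorem continuous_Q : Continuous Q := by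
  have := continuous_sigma
  unfold Q; fun_prop

theorem sigma_eq_zero_iff (x : State) : sigma x = 0 ↔ x 0 = 0 ∧ x 1 = 0 := by
  constructor
  · intro h
    have := sigma_sq x
    rw [h] at this
    constructor <;> nlinarith [sq_nonneg (x 0), sq_nonneg (x 1)]
  · rintro ⟨h0, h1⟩
    simp [sigma, h0, h1]

theorem sigma_pos_of_regular {x : State} (hx : x ∈ regular) : 0 < sigma x :=
  (sigma_nonneg x).lt_of_ne' hx.1

theorem eq_zero_iff (x : State) : x = 0 ↔ sigma x = 0 ∧ x 2 = 0 := by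
  rw [sigma_eq_zero_iff]
  constructor
  · rintro rfl; simp
  · rintro ⟨⟨h0, h1⟩, h2⟩
    ext i; fin_cases i <;> simp [h0, h1, h2]

theorem ne_zero_of_regular {x : State} (hx : x ∈ regular) : x ≠ 0 := by
  rintro rfl; exact hx.2 (by simp)

theorem isOpen_regular : IsOpen regular :=
  (isOpen_ne_fun continuous_sigma continuous_const).inter
    (isOpen_ne_fun (by fun_prop) continuous_const)

theorem mem_regular_of_notMem_exceptional {x : State} (hx : x ∉ exceptional) (h : x 2 ≠ 0) :
    x ∈ regular := ⟨fun hs => hx ⟨hs, h⟩, h⟩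

theorem norm_sq_state (x : State) : ‖x‖ ^ 2 = sigma x ^ 2 + x 2 ^ 2 := by
  rw [EuclideanSpace.real_norm_sq_eq, Fin.sum_univ_three, sigma_sq]

theorem norm_sq_control (u : Control) : ‖u‖ ^ 2 = u 0 ^ 2 + u 1 ^ 2 := by
  rw [EuclideanSpace.real_norm_sq_eq, Fin.sum_univ_two]

theorem norm_sq_le_Q (x : State) : ‖x‖ ^ 2 ≤ 3 * Q x := by
  rw [norm_sq_state, Q, ← sq_abs (x 2)]
  -- Twice the difference of the two sides is `(2σ - 3|x₃|)² + x₃²`.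
  nlinarith [sq_nonneg (sigma x - 2 * |x 2|), sq_nonneg (sigma x - |x 2|),
    sq_nonneg (2 * sigma x - 3 * |x 2|)]

theorem Q_nonneg (x : State) : 0 ≤ Q x := by unfold Q; positivity

/-- One quarter of the squared norm of the speed gradient, as a function of `σ` and `|x₃|`. -/
def gradSq (x : State) : ℝ := (sigma x - |x 2|) ^ 2 + sigma x ^ 2 * (2 * |x 2| - sigma x) ^ 2

theorem continuous_gradSq : Continuous gradSq := by
  have := continuous_sigma
  unfold gradSq; fun_prop

/-- If both squares vanish, the first forces `σ = |x₃|`, and the second then equals `σ⁴`. -/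
theorem gradSq_pos {x : State} (hx : x ≠ 0) : 0 < gradSq x := by
  have h0 : 0 ≤ gradSq x := by unfold gradSq; positivity
  refine h0.lt_of_ne' fun h => hx ?_
  unfold gradSq at h
  have h1 : sigma x - |x 2| = 0 := by
    nlinarith [sq_nonneg (sigma x - |x 2|), sq_nonneg (sigma x * (2 * |x 2| - sigma x))]
  have h2 : |x 2| = sigma x := by linarith
  rw [h2] at h
  have h3 : sigma x = 0 := by
    have : sigma x ^ 4 = 0 := by linear_combination h
    exact pow_eq_zero_iff (by norm_num) |>.1 this
  rw [eq_zero_iff]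
  exact ⟨h3, by simpa [h3] using h2⟩

theorem radial_gradOmega {x : State} (hx : x ∈ regular) :
    x 0 * gradOmega x 0 + x 1 * gradOmega x 1 = 2 * sigma x * (sigma x - |x 2|) := by
  have hs := hx.1
  have h := sigma_sq x
  simp only [gradOmega, PiLp.toLp_apply, Matrix.cons_val_zero, Matrix.cons_val_one]
  field_simp
  linear_combination (-2 * sigma x + 2 * |x 2|) * h

theorem vertical_gradOmega {x : State} (hx : x ∈ regular) :
    x 0 * gradOmega x 1 - x 1 * gradOmega x 0
      = 2 * Real.sign (x 2) * sigma x ^ 2 * (2 * |x 2| - sigma x) := by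
  have hs := hx.1
  have h := sigma_sq x
  have hz : Real.sign (x 2) * |x 2| = x 2 := by
    rcases lt_or_gt_of_ne hx.2 with h | h
    · simp [Real.sign_of_neg h, abs_of_neg h]
    · simp [Real.sign_of_pos h, abs_of_pos h]
  simp only [gradOmega, PiLp.toLp_apply, Matrix.cons_val_zero, Matrix.cons_val_one]
  field_simp
  linear_combination (-4 * x 2 + 2 * Real.sign (x 2) * sigma x) * sigma x * h
    - 4 * sigma x ^ 3 * hz

theorem norm_sq_gradOmega {x : State} (hx : x ∈ regular) :
    ‖gradOmega x‖ ^ 2 = 4 * gradSq x := by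
  have hs := hx.1
  have h := sigma_sq x
  have h1 := radial_gradOmega hx
  have h2 := vertical_gradOmega hx
  have hz : Real.sign (x 2) ^ 2 = 1 := by
    rcases lt_or_gt_of_ne hx.2 with h | h
    · simp [Real.sign_of_neg h]
    · simp [Real.sign_of_pos h]
  -- Lagrange's identity `|p|²|q|² = (p · q)² + (p × q)²` in the plane, with `p = (x₁, x₂)` and `q =
  -- G`.
  have h3 : sigma x ^ 2 * ‖gradOmega x‖ ^ 2 = sigma x ^ 2 * (4 * gradSq x) := by
    rw [norm_sq_control]
    calc sigma x ^ 2 * (gradOmega x 0 ^ 2 + gradOmega x 1 ^ 2)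
        = (x 0 * gradOmega x 0 + x 1 * gradOmega x 1) ^ 2
          + (x 0 * gradOmega x 1 - x 1 * gradOmega x 0) ^ 2 := by rw [h]; ring
      _ = sigma x ^ 2 * (4 * gradSq x) := by
        rw [h1, h2, gradSq]
        linear_combination 4 * sigma x ^ 4 * (2 * |x 2| - sigma x) ^ 2 * hz
  exact mul_left_cancel₀ (pow_ne_zero 2 hs) h3

theorem norm_gradOmega_pos {x : State} (hx : x ∈ regular) : 0 < ‖gradOmega x‖ := by
  refine (norm_nonneg _).lt_of_ne' fun h => ?_
  have h1 := norm_sq_gradOmega hx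
  rw [h] at h1
  linarith [gradSq_pos (ne_zero_of_regular hx)]

/-! ### Size and components of the feedback -/

variable {γ : ℝ} {v : ℝ → Control}

theorem feedback_zero (γ : ℝ) (v : ℝ → Control) : feedback γ v 0 = 0 := by simp [feedback]

theorem feedback_of_regular {x : State} (hx : x ∈ regular) :
    feedback γ v x = (-γ * ‖gradOmega x‖⁻¹) • gradOmega x := by
  rw [feedback, if_neg (ne_zero_of_regular hx), if_neg hx.2, if_neg hx.1]

/-- The origin needs no exception: both sides vanish there. -/
theorem feedback_of_plane {x : State} (h : x 2 = 0) :
    feedback γ v x = (-γ * (sigma x)⁻¹) • !₂[x 0, x 1] := by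
  by_cases hx : x = 0
  · subst hx
    ext i; fin_cases i <;> simp [feedback]
  · rw [feedback, if_neg hx, if_pos h]

theorem norm_feedback (hγ : 0 < γ) (hv : ∀ s : ℝ, s ≠ 0 → ‖v s‖ = 1) {x : State} (hx : x ≠ 0) :
    ‖feedback γ v x‖ = γ := by
  by_cases h2 : x 2 = 0
  · have hs : 0 < sigma x :=
      (sigma_nonneg x).lt_of_ne' fun hs => hx ((eq_zero_iff x).2 ⟨hs, h2⟩)
    have h : ‖(!₂[x 0, x 1] : Control)‖ = sigma x := by
      rw [EuclideanSpace.norm_eq, Fin.sum_univ_two]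
      simp [sigma]
    rw [feedback_of_plane h2, norm_smul, h, norm_mul, norm_neg, norm_inv, Real.norm_of_nonneg hγ.le,
      Real.norm_of_nonneg hs.le]
    field_simp
  · by_cases hs : sigma x = 0
    · rw [feedback, if_neg hx, if_neg h2, if_pos hs, norm_smul, hv _ h2,
        Real.norm_of_nonneg hγ.le, mul_one]
    · have hr : x ∈ regular := ⟨hs, h2⟩
      have := norm_gradOmega_pos hr
      rw [feedback_of_regular hr, norm_smul, norm_mul, norm_neg, norm_inv, norm_norm,
        Real.norm_of_nonneg hγ.le]
      field_simp

theorem feedback_sq_le (hv : ∀ s : ℝ, s ≠ 0 → ‖v s‖ = 1) {ε : ℝ} (hε : 0 < ε) (x : State) :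
    feedback (Real.sqrt ε) v x 0 ^ 2 + feedback (Real.sqrt ε) v x 1 ^ 2 ≤ ε := by
  rw [← norm_sq_control]
  by_cases hx : x = 0
  · subst hx; simp [feedback_zero, hε.le]
  · rw [norm_feedback (Real.sqrt_pos.2 hε) hv hx, Real.sq_sqrt hε.le]

@[simp] theorem closedLoop_apply_zero (x : State) :
    closedLoop γ v x 0 = feedback γ v x 0 := by simp [closedLoop, field]

@[simp] theorem closedLoop_apply_one (x : State) :
    closedLoop γ v x 1 = feedback γ v x 1 := by simp [closedLoop, field]

@[simp] theorem closedLoop_apply_two (x : State) :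
    closedLoop γ v x 2 = x 0 * feedback γ v x 1 - x 1 * feedback γ v x 0 := by
  simp [closedLoop, field]

theorem closedLoop_zero : closedLoop γ v 0 = 0 := by
  ext i; fin_cases i <;> simp [feedback_zero]

theorem radial_feedback_of_regular {x : State} (hx : x ∈ regular) :
    x 0 * feedback γ v x 0 + x 1 * feedback γ v x 1
      = -γ * ‖gradOmega x‖⁻¹ * (2 * sigma x * (sigma x - |x 2|)) := by
  rw [feedback_of_regular hx, ← radial_gradOmega hx]
  simp only [PiLp.smul_apply, smul_eq_mul]
  ring

theorem vertical_feedback_of_regular {x : State} (hx : x ∈ regular) :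
    x 0 * feedback γ v x 1 - x 1 * feedback γ v x 0
      = -γ * ‖gradOmega x‖⁻¹ * (2 * Real.sign (x 2) * sigma x ^ 2 * (2 * |x 2| - sigma x)) := by
  rw [feedback_of_regular hx, ← vertical_gradOmega hx]
  simp only [PiLp.smul_apply, smul_eq_mul]
  ring

theorem vertical_feedback_of_plane {x : State} (hx : x 2 = 0) :
    x 0 * feedback γ v x 1 - x 1 * feedback γ v x 0 = 0 := by
  rw [feedback_of_plane hx]
  simp only [PiLp.smul_apply, smul_eq_mul, Matrix.cons_val_zero,
    Matrix.cons_val_one]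
  ring

theorem radial_feedback_of_plane {x : State} (hx : x 2 = 0) :
    x 0 * feedback γ v x 0 + x 1 * feedback γ v x 1 = -γ * sigma x := by
  rw [feedback_of_plane hx]
  simp only [PiLp.smul_apply, smul_eq_mul, Matrix.cons_val_zero,
    Matrix.cons_val_one]
  by_cases hs : sigma x = 0
  · simp [hs]
  · have := sigma_sq x
    field_simp
    linear_combination γ * this

/-- The control points along `-G`, whose radial part has the sign of `|x₃| - σ`. On the axis the
product is zero whatever `v` is. -/
theorem radial_feedback_nonneg (hγ : 0 < γ) {x : State} (h : sigma x < |x 2|) :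
    0 ≤ x 0 * feedback γ v x 0 + x 1 * feedback γ v x 1 := by
  by_cases hs : sigma x = 0
  · obtain ⟨h0, h1⟩ := (sigma_eq_zero_iff x).1 hs
    simp [h0, h1]
  · have h2 : x 2 ≠ 0 := abs_pos.1 ((sigma_nonneg x).trans_lt h)
    rw [radial_feedback_of_regular ⟨hs, h2⟩]
    have : 0 ≤ γ * ‖gradOmega x‖⁻¹ * (2 * sigma x * (|x 2| - sigma x)) := by
      have := sub_pos.2 h
      have := sigma_nonneg x
      positivity
    linarith

/-- Only `σ < 2|x₃|` matters. There the angular part of `G` gives `2σ(2|x₃| - σ) ≤ |G|`, and the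
remaining factor `σ` is at most `2|x₃|`, so the bound is quadratic in `x₃` and excludes reaching
zero in finite time. -/
theorem vertical_feedback_ge (hγ : 0 < γ) (x : State) :
    -(2 * γ * x 2 ^ 2) ≤ x 2 * (x 0 * feedback γ v x 1 - x 1 * feedback γ v x 0) := by
  by_cases h2 : x 2 = 0
  · simp [h2]
  by_cases hs : sigma x = 0
  · obtain ⟨h0, h1⟩ := (sigma_eq_zero_iff x).1 hs
    simp only [h0, h1]
    have : 0 ≤ 2 * γ * x 2 ^ 2 := by positivity
    linarith
  have hr : x ∈ regular := ⟨hs, h2⟩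
  have hn := norm_gradOmega_pos hr
  have hs' := sigma_pos_of_regular hr
  have hw : 0 < |x 2| := abs_pos.2 h2
  have hz : x 2 * Real.sign (x 2) = |x 2| := by
    rcases lt_or_gt_of_ne h2 with h | h
    · simp [Real.sign_of_neg h, abs_of_neg h]
    · simp [Real.sign_of_pos h, abs_of_pos h]
  have hle : sigma x ^ 2 * (2 * |x 2| - sigma x) ≤ |x 2| * ‖gradOmega x‖ := by
    rcases le_or_gt (2 * |x 2|) (sigma x) with h | h
    · have : 0 ≤ sigma x ^ 2 * (sigma x - 2 * |x 2|) := by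
        have := sub_nonneg.2 h
        positivity
      have : 0 ≤ |x 2| * ‖gradOmega x‖ := by positivity
      linarith
    · have h1 : 0 ≤ sigma x * (2 * |x 2| - sigma x) := by
        have := sub_pos.2 h
        positivity
      have hN : 2 * (sigma x * (2 * |x 2| - sigma x)) ≤ ‖gradOmega x‖ := by
        refine pow_le_pow_iff_left₀ (by positivity) hn.le two_ne_zero |>.1 ?_
        rw [norm_sq_gradOmega hr, gradSq]
        nlinarith [sq_nonneg (sigma x - |x 2|)]
      nlinarith
  rw [vertical_feedback_of_regular hr, ← sq_abs (x 2)]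
  have : x 2 * (-γ * ‖gradOmega x‖⁻¹ * (2 * Real.sign (x 2) * sigma x ^ 2 * (2 * |x 2| - sigma x)))
      = -(2 * γ * |x 2| * ((sigma x ^ 2 * (2 * |x 2| - sigma x)) / ‖gradOmega x‖)) := by
    rw [← hz]; field_simp
  rw [this, neg_le_neg_iff]
  have h3 : (sigma x ^ 2 * (2 * |x 2| - sigma x)) / ‖gradOmega x‖ ≤ |x 2| := by
    rw [div_le_iff₀ hn]; exact hle
  have h4 : 0 ≤ 2 * γ * |x 2| := by positivity
  nlinarith [mul_le_mul_of_nonneg_left h3 h4]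

theorem omega_feedback {x : State} (hx : x ∈ regular) :
    omega x (feedback γ v x) = -γ * ‖gradOmega x‖ := by
  have h (u : Control) : omega x u = gradOmega x 0 * u 0 + gradOmega x 1 * u 1 := by
    simp [omega, gradOmega]; ring
  have hn := norm_gradOmega_pos hx
  rw [h, feedback_of_regular hx]
  simp only [PiLp.smul_apply, smul_eq_mul]
  have := norm_sq_control (gradOmega x)
  field_simp
  linear_combination γ * this

/-! ### Smoothness of the closed loop off the plane and the axis -/

theorem contDiffAt_sigma {x : State} (hx : sigma x ≠ 0) : ContDiffAt ℝ 1 sigma x := by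
  have h : x 0 ^ 2 + x 1 ^ 2 ≠ 0 := by
    rw [← sigma_sq]; exact pow_ne_zero 2 hx
  have h1 : ContDiffAt ℝ 1 (fun y : State => y 0 ^ 2 + y 1 ^ 2) x := by fun_prop
  exact h1.sqrt h

theorem contDiffAt_gradOmega {x : State} (hx : x ∈ regular) : ContDiffAt ℝ 1 gradOmega x := by
  have hs := contDiffAt_sigma hx.1
  have h2 : ContDiffAt ℝ 1 (fun y : State => y 2) x := by fun_prop
  have ha : ContDiffAt ℝ 1 (fun y : State => |y 2|) x := by
    simpa only [Real.norm_eq_abs] using h2.norm ℝ hx.2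
  have hsg : ContDiffAt ℝ 1 (fun y : State => Real.sign (y 2)) x := by
    have hc : ContinuousAt (fun y : State => y 2) x := h2.continuousAt
    refine (contDiffAt_const (c := Real.sign (x 2))).congr_of_eventuallyEq ?_
    rcases lt_or_gt_of_ne hx.2 with h | h
    · filter_upwards [hc.eventually_lt_const h] with y hy
      rw [Real.sign_of_neg hy, Real.sign_of_neg h]
    · filter_upwards [hc.eventually_const_lt h] with y hy
      rw [Real.sign_of_pos hy, Real.sign_of_pos h]
  have h0 : ContDiffAt ℝ 1 (fun y : State => y 0) x := by fun_prop
  have h1 : ContDiffAt ℝ 1 (fun y : State => y 1) x := by fun_prop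
  rw [contDiffAt_euclidean]
  intro i
  fin_cases i
  · simp only [gradOmega]
    exact (((contDiffAt_const.mul h0).sub ((contDiffAt_const.mul h1).mul h2)).sub
      (contDiffAt_const.mul ((ha.mul h0).div hs hx.1))).add
      (((contDiffAt_const.mul hsg).mul h1).mul hs)
  · simp only [gradOmega]
    exact (((contDiffAt_const.mul h1).add ((contDiffAt_const.mul h0).mul h2)).sub
      (contDiffAt_const.mul ((ha.mul h1).div hs hx.1))).sub
      (((contDiffAt_const.mul hsg).mul h0).mul hs)

theorem contDiffAt_feedback {x : State} (hx : x ∈ regular) :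
    ContDiffAt ℝ 1 (feedback γ v) x := by
  have hg := contDiffAt_gradOmega hx
  have hn := norm_gradOmega_pos hx
  have h : ContDiffAt ℝ 1 (fun y => (-γ * ‖gradOmega y‖⁻¹) • gradOmega y) x :=
    (contDiffAt_const.mul ((hg.norm ℝ (norm_pos_iff.1 hn)).inv hn.ne')).smul hg
  refine h.congr_of_eventuallyEq ?_
  filter_upwards [isOpen_regular.mem_nhds hx] with y hy
  exact feedback_of_regular hy

theorem contDiffAt_closedLoop {x : State} (hx : x ∈ regular) :
    ContDiffAt ℝ 1 (closedLoop γ v) x := by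
  have hu := contDiffAt_feedback (γ := γ) (v := v) hx
  rw [contDiffAt_euclidean] at hu ⊢
  have h0 : ContDiffAt ℝ 1 (fun y : State => y 0) x := by fun_prop
  have h1 : ContDiffAt ℝ 1 (fun y : State => y 1) x := by fun_prop
  intro i
  fin_cases i
  · simpa using hu 0
  · simpa using hu 1
  · simpa using (h0.mul (hu 1)).sub (h1.mul (hu 0))

/-! ### Absolutely continuous functions on an interval -/

section AbsolutelyContinuous

theorem absolutelyContinuousOnInterval_of_dist_le {X Y : Type*} [PseudoMetricSpace X]
    [PseudoMetricSpace Y] {f : ℝ → X} {g : ℝ → Y} {a b : ℝ}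
    (hf : AbsolutelyContinuousOnInterval f a b) (h : ∀ s t, dist (g s) (g t) ≤ dist (f s) (f t)) :
    AbsolutelyContinuousOnInterval g a b :=
  squeeze_zero (fun _ => Finset.sum_nonneg fun _ _ => dist_nonneg)
    (fun _ => Finset.sum_le_sum fun _ _ => h _ _) hf

theorem absolutelyContinuousOnInterval_apply {ι : Type*} [Fintype ι] {y : ℝ → EuclideanSpace ℝ ι}
    {a b : ℝ} (hy : AbsolutelyContinuousOnInterval y a b) (i : ι) :
    AbsolutelyContinuousOnInterval (fun t => y t i) a b :=
  absolutelyContinuousOnInterval_of_dist_le hy fun s t => by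
    rw [dist_eq_norm, dist_eq_norm]
    exact PiLp.norm_apply_le (y s - y t) i

theorem ae_mem_Ioo_of_mem_Icc (a b : ℝ) : ∀ᵐ t : ℝ, t ∈ Icc a b → t ∈ Ioo a b := by
  have ha : ∀ᵐ t : ℝ, t ≠ a := by simp [ae_iff, measure_singleton]
  have hb : ∀ᵐ t : ℝ, t ≠ b := by simp [ae_iff, measure_singleton]
  filter_upwards [ha, hb] with t h1 h2 h
  exact ⟨h.1.lt_of_ne' h1, h.2.lt_of_ne h2⟩

/-- An absolutely continuous function with nonnegative derivative almost everywhere increases. -/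
theorem le_of_ae_hasDerivAt_nonneg {g : ℝ → ℝ} {a b : ℝ} (hab : a ≤ b)
    (hg : AbsolutelyContinuousOnInterval g a b)
    (h : ∀ᵐ t, t ∈ Ioo a b → ∃ d, 0 ≤ d ∧ HasDerivAt g d t) : g a ≤ g b := by
  rw [← sub_nonneg, ← hg.integral_deriv_eq_sub]
  refine intervalIntegral.integral_nonneg_of_ae_restrict hab ?_
  rw [EventuallyLE, ae_restrict_iff' measurableSet_Icc]
  filter_upwards [h, ae_mem_Ioo_of_mem_Icc a b] with t h1 h2 h3
  obtain ⟨d, hd, hd'⟩ := h1 (h2 h3)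
  rw [hd'.deriv]
  exact hd

/-- There are points of differentiability in every nondegenerate interval. -/
theorem exists_mem_Ioo_of_ae {p : ℝ → Prop} {a b : ℝ} (hab : a < b)
    (h : ∀ᵐ t, t ∈ Ioo a b → p t) : ∃ t ∈ Ioo a b, p t := by
  by_contra! hn
  have h0 : volume (Ioo a b) = 0 :=
    measure_mono_null (fun t ht => by simpa using ⟨ht.1, ht.2, hn t ht⟩) (ae_iff.1 h)
  rw [Real.volume_Ioo] at h0
  exact absurd hab (by simpa using h0)

end AbsolutelyContinuous

/-! ### A priori estimates and invariance of the regular set -/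

/-- Absolutely continuous solutions of `ẏ = F(y)` on `[a, b]`. -/
def IsTraj (F : State → State) (y : ℝ → State) (a b : ℝ) : Prop :=
  AbsolutelyContinuousOnInterval y a b ∧ ∀ᵐ t : ℝ, t ∈ Ioo a b → HasDerivAt y (F (y t)) t

theorem IsTraj.mono {F : State → State} {y : ℝ → State} {a b c d : ℝ} (h : IsTraj F y a b)
    (hac : a ≤ c) (hcd : c ≤ d) (hdb : d ≤ b) : IsTraj F y c d := by
  refine ⟨h.1.mono ?_, ?_⟩
  · rw [uIcc_of_le hcd, uIcc_of_le (hac.trans (hcd.trans hdb))]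
    exact Icc_subset_Icc hac hdb
  · filter_upwards [h.2] with t ht hm
    exact ht (Ioo_subset_Ioo hac hdb hm)

theorem IsTraj.continuousOn {F : State → State} {y : ℝ → State} {a b : ℝ} (h : IsTraj F y a b)
    (hab : a ≤ b) : ContinuousOn y (Icc a b) := by
  simpa [uIcc_of_le hab] using h.1.continuousOn

theorem IsSolution.isTraj {F : State → State} {y : ℝ → State} (h : IsSolution F y) {a b : ℝ}
    (ha : 0 ≤ a) (hab : a ≤ b) : IsTraj F y a b := by
  have h0 : IsTraj F y 0 b := ⟨h.1 b (ha.trans hab), by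
    filter_upwards [h.2] with t ht hm
    exact ht hm.1.le⟩
  exact h0.mono ha hab le_rfl

theorem isTraj_of_hasDerivWithinAt {F : State → State} {y : ℝ → State} {a b : ℝ} (hab : a ≤ b)
    (h : ∀ t ∈ Icc a b, HasDerivWithinAt y (F (y t)) (Icc a b) t)
    (hF : ContinuousOn (fun t => F (y t)) (Icc a b)) : IsTraj F y a b := by
  refine ⟨?_, Eventually.of_forall fun t ht =>
    (h t (Ioo_subset_Icc_self ht)).hasDerivAt (Icc_mem_nhds ht.1 ht.2)⟩
  obtain ⟨C, hC⟩ := isCompact_Icc.exists_bound_of_continuousOn hF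
  have hL : LipschitzOnWith C.toNNReal y (Icc a b) :=
    (convex_Icc a b).lipschitzOnWith_of_nnnorm_hasDerivWithin_le h fun t ht => by
      rw [← NNReal.coe_le_coe]
      simpa using (hC t ht).trans (le_max_left C 0)
  rw [← uIcc_of_le hab] at hL
  exact hL.absolutelyContinuousOnInterval

/-- The vector field `F` is the closed-loop field, slowed down by a state-dependent factor. -/
def IsSlowdown (γ : ℝ) (v : ℝ → Control) (F : State → State) : Prop :=
  ∀ x, ∃ c ∈ Icc (0 : ℝ) 1, F x = c • closedLoop γ v x

variable {F : State → State} {y : ℝ → State} {a b : ℝ}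

theorem isSlowdown_closedLoop : IsSlowdown γ v (closedLoop γ v) :=
  fun x => ⟨1, by simp, by simp⟩

theorem IsSlowdown.radial_nonneg (hF : IsSlowdown γ v F) (hγ : 0 < γ) {x : State}
    (h : sigma x < |x 2|) : 0 ≤ x 0 * F x 0 + x 1 * F x 1 := by
  obtain ⟨c, hc, hx⟩ := hF x
  have := mul_nonneg hc.1 (radial_feedback_nonneg (v := v) hγ h)
  simp only [hx, PiLp.smul_apply, smul_eq_mul, closedLoop_apply_zero, closedLoop_apply_one]
  linarith

theorem IsSlowdown.vertical_ge (hF : IsSlowdown γ v F) (hγ : 0 < γ) (x : State) :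
    -(2 * γ * x 2 ^ 2) ≤ x 2 * F x 2 := by
  obtain ⟨c, hc, hx⟩ := hF x
  have := mul_le_mul_of_nonneg_left (vertical_feedback_ge (v := v) hγ x) hc.1
  simp only [hx, PiLp.smul_apply, smul_eq_mul, closedLoop_apply_two]
  have h0 : 0 ≤ 2 * γ * x 2 ^ 2 := by positivity
  nlinarith [hc.2]

theorem hasDerivAt_apply {y : ℝ → State} {y' : State} {t : ℝ} (h : HasDerivAt y y' t) (i : Fin 3) :
    HasDerivAt (fun s => y s i) (y' i) t :=
  (EuclideanSpace.proj i : State →L[ℝ] ℝ).hasFDerivAt.comp_hasDerivAt t h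

theorem hasDerivAt_sigma_sq {y : ℝ → State} {y' : State} {t : ℝ} (h : HasDerivAt y y' t) :
    HasDerivAt (fun s => sigma (y s) ^ 2) (2 * (y t 0 * y' 0 + y t 1 * y' 1)) t := by
  simp_rw [sigma_sq]
  refine (((hasDerivAt_apply h 0).pow 2).add ((hasDerivAt_apply h 1).pow 2)).congr_deriv ?_
  simp only [Nat.cast_ofNat, Nat.add_one_sub_one, pow_one]
  ring

theorem absolutelyContinuousOnInterval_sigma_sq {y : ℝ → State}
    (h : AbsolutelyContinuousOnInterval y a b) :
    AbsolutelyContinuousOnInterval (fun s => sigma (y s) ^ 2) a b := by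
  simp_rw [sigma_sq, sq]
  have h0 := absolutelyContinuousOnInterval_apply h 0
  have h1 := absolutelyContinuousOnInterval_apply h 1
  exact (h0.fun_mul h0).fun_add (h1.fun_mul h1)

/-- The third coordinate decays at most exponentially. -/
theorem IsTraj.vertical_sq_ge (hF : IsSlowdown γ v F) (hγ : 0 < γ) (hab : a ≤ b)
    (hy : IsTraj F y a b) : y a 2 ^ 2 * Real.exp (4 * γ * a) ≤ y b 2 ^ 2 * Real.exp (4 * γ * b) := by
  have h2 := absolutelyContinuousOnInterval_apply hy.1 2
  have he : AbsolutelyContinuousOnInterval (fun t => Real.exp (4 * γ * t)) a b :=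
    ContDiffOn.absolutelyContinuousOnInterval (by fun_prop)
  have h := (h2.fun_mul h2).fun_mul he
  simp only [← sq] at h
  refine le_of_ae_hasDerivAt_nonneg hab h ?_
  filter_upwards [hy.2] with t ht hm
  have hd := hasDerivAt_apply (ht hm) 2
  have hE : HasDerivAt (fun t => Real.exp (4 * γ * t)) (Real.exp (4 * γ * t) * (4 * γ * 1)) t :=
    ((hasDerivAt_id t).const_mul (4 * γ)).exp
  refine ⟨_, ?_, (hd.pow 2).mul hE⟩
  have h1 := hF.vertical_ge hγ (y t)
  have h3 : 0 ≤ Real.exp (4 * γ * t) * (2 * (y t 2 * F (y t) 2) + 4 * γ * y t 2 ^ 2) :=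
    mul_nonneg (Real.exp_pos _).le (by linarith)
  refine h3.trans_eq ?_
  simp
  ring

theorem IsTraj.vertical_ne_zero (hF : IsSlowdown γ v F) (hγ : 0 < γ) (hab : a ≤ b)
    (hy : IsTraj F y a b) (h : y a 2 ≠ 0) : y b 2 ≠ 0 := by
  intro hb
  have h1 := hy.vertical_sq_ge hF hγ hab
  have h2 : 0 < y a 2 ^ 2 * Real.exp (4 * γ * a) := by positivity
  rw [hb] at h1
  simp at h1
  linarith

theorem IsTraj.abs_vertical_ge (hF : IsSlowdown γ v F) (hγ : 0 < γ) (hab : a ≤ b)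
    (hy : IsTraj F y a b) : |y a 2| * Real.exp (-(2 * γ * (b - a))) ≤ |y b 2| := by
  have h1 := hy.vertical_sq_ge hF hγ hab
  refine abs_le_of_sq_le_sq' ?_ (abs_nonneg _) |>.2
  rw [mul_pow, sq_abs, sq_abs, ← Real.exp_nat_mul]
  have h2 : Real.exp (4 * γ * a) = Real.exp ((2 : ℕ) * -(2 * γ * (b - a))) * Real.exp (4 * γ * b) := by
    rw [← Real.exp_add]; congr 1; push_cast; ring
  rw [h2, ← mul_assoc] at h1
  exact le_of_mul_le_mul_right h1 (Real.exp_pos _)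

theorem IsTraj.sigma_monotone (hF : IsSlowdown γ v F) (hγ : 0 < γ) (hab : a ≤ b)
    (hy : IsTraj F y a b) (h : ∀ t ∈ Ioo a b, sigma (y t) < |y t 2|) :
    sigma (y a) ≤ sigma (y b) := by
  refine abs_le_of_sq_le_sq' ?_ (sigma_nonneg _) |>.2
  refine le_of_ae_hasDerivAt_nonneg hab (absolutelyContinuousOnInterval_sigma_sq hy.1) ?_
  filter_upwards [hy.2] with t ht hm
  exact ⟨_, by linarith [hF.radial_nonneg hγ (h t hm)], hasDerivAt_sigma_sq (ht hm)⟩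

/-- While `|x₃| ≥ m`, the distance to the axis cannot fall below `m`. -/
theorem IsTraj.le_sigma (hF : IsSlowdown γ v F) (hγ : 0 < γ) (hab : a ≤ b)
    (hy : IsTraj F y a b) {m : ℝ} (hm : ∀ t ∈ Icc a b, m ≤ |y t 2|) (ha : m ≤ sigma (y a)) :
    m ≤ sigma (y b) := by
  by_contra! hb
  have hc : ContinuousOn (fun t => sigma (y t)) (Icc a b) :=
    continuous_sigma.comp_continuousOn (hy.continuousOn hab)
  have hcl : IsClosed (Icc a b ∩ (fun t => sigma (y t)) ⁻¹' Ici m) :=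
    hc.preimage_isClosed_of_isClosed isClosed_Icc isClosed_Ici
  have hcpt := isCompact_Icc.of_isClosed_subset hcl inter_subset_left
  -- Let `c` be the last time with `σ ≥ m`. After it `σ < m ≤ |x₃|`, so `σ` does not decrease from
  -- `c` to `b`.
  obtain ⟨c, ⟨hcI, hcm⟩, hmax⟩ := hcpt.exists_isGreatest ⟨a, ⟨le_rfl, hab⟩, ha⟩
  have h1 := (hy.mono hcI.1 hcI.2 le_rfl).sigma_monotone hF hγ hcI.2 fun t ht => by
    have htI : t ∈ Icc a b := ⟨hcI.1.trans ht.1.le, ht.2.le⟩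
    refine lt_of_lt_of_le ?_ (hm t htI)
    by_contra! hle
    exact absurd (hmax ⟨htI, hle⟩) (not_le.2 ht.1)
  exact absurd (hcm.trans h1) (not_le.2 hb)

/-- The explicit lower bound on `σ` is kept because it supplies the compact set needed for existence
in `exists_isTraj`. -/
theorem IsTraj.mem_regular (hF : IsSlowdown γ v F) (hγ : 0 < γ) (hab : a ≤ b)
    (hy : IsTraj F y a b) (ha : y a ∈ regular) :
    min (sigma (y a)) (|y a 2| * Real.exp (-(2 * γ * (b - a)))) ≤ sigma (y b) ∧
      y b ∈ regular := by
  have hle : min (sigma (y a)) (|y a 2| * Real.exp (-(2 * γ * (b - a)))) ≤ sigma (y b) := by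
    refine hy.le_sigma hF hγ hab (fun t ht => (min_le_right _ _).trans ?_) (min_le_left _ _)
    refine le_trans ?_ ((hy.mono le_rfl ht.1 ht.2).abs_vertical_ge hF hγ ht.1)
    gcongr
    exact ht.2
  have hpos : 0 < min (sigma (y a)) (|y a 2| * Real.exp (-(2 * γ * (b - a)))) :=
    lt_min (sigma_pos_of_regular ha) (mul_pos (abs_pos.2 ha.2) (Real.exp_pos _))
  exact ⟨hle, (hpos.trans_le hle).ne', hy.vertical_ne_zero hF hγ hab ha.2⟩

theorem closedLoop_sq_add_sq (hγ : 0 < γ) (hv : ∀ s : ℝ, s ≠ 0 → ‖v s‖ = 1)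
    {x : State} (hx : x ≠ 0) : closedLoop γ v x 0 ^ 2 + closedLoop γ v x 1 ^ 2 = γ ^ 2 := by
  rw [closedLoop_apply_zero, closedLoop_apply_one, ← norm_sq_control, norm_feedback hγ hv hx]

/-- The exceptional set cannot be reached from outside. -/
theorem IsTraj.notMem_exceptional (hγ : 0 < γ) (hv : ∀ s : ℝ, s ≠ 0 → ‖v s‖ = 1) (hab : a ≤ b)
    (hy : IsTraj (closedLoop γ v) y a b) (ha : y a ∉ exceptional) : y b ∉ exceptional := by
  intro hb
  have hlt : a < b := hab.lt_of_ne (by rintro rfl; exact ha hb)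
  have hyc := hy.continuousOn hab
  have hcont : ContinuousWithinAt (fun t => |y t 2| - sigma (y t)) (Icc a b) b := by
    have h1 : Continuous fun x : State => |x 2| - sigma x := by
      have := continuous_sigma
      fun_prop
    exact (h1.comp_continuousOn hyc) b ⟨hab, le_rfl⟩
  have hpos : 0 < |y b 2| - sigma (y b) := by
    rw [hb.1, sub_zero]; exact abs_pos.2 hb.2
  have hev : ∀ᶠ t in 𝓝[Icc a b] b, 0 < |y t 2| - sigma (y t) :=
    hcont.eventually (lt_mem_nhds hpos)
  obtain ⟨l, hl, hsub⟩ := (mem_nhdsLE_iff_exists_mem_Ico_Ioc_subset hlt).1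
    (nhdsWithin_le_of_mem (Icc_mem_nhdsLE hlt) hev)
  -- On `(l, b]` the inequality `σ < |x₃|` makes `σ` nondecreasing, and it ends at `0`.
  have hz (t : ℝ) (ht : t ∈ Ioc l b) : sigma (y t) = 0 := by
    have h := (hy.mono (hl.1.trans ht.1.le) ht.2 le_rfl).sigma_monotone isSlowdown_closedLoop hγ
      ht.2 fun s hs => sub_pos.1 (hsub ⟨ht.1.trans hs.1, hs.2.le⟩)
    rw [hb.1] at h
    exact le_antisymm h (sigma_nonneg _)
  obtain ⟨t, ht, hd⟩ := exists_mem_Ioo_of_ae hl.2 (hy.mono hl.1 hl.2.le le_rfl).2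
  have hnz : y t ≠ 0 := by
    intro h0
    have := hsub ⟨ht.1, ht.2.le⟩
    simp [h0, sigma] at this
  have hder (i : Fin 3) (hi : ∀ x : State, sigma x = 0 → x i = 0) : closedLoop γ v (y t) i = 0 := by
    refine (hasDerivAt_apply hd i).unique ((hasDerivAt_const t (0 : ℝ)).congr_of_eventuallyEq ?_)
    filter_upwards [Ioo_mem_nhds ht.1 ht.2] with s hs
    exact hi _ (hz s ⟨hs.1, hs.2.le⟩)
  have h := closedLoop_sq_add_sq hγ hv hnz
  rw [hder 0 fun x hx => ((sigma_eq_zero_iff x).1 hx).1,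
    hder 1 fun x hx => ((sigma_eq_zero_iff x).1 hx).2] at h
  nlinarith

/-! ### Decay of `Q`, cut-off fields, uniqueness and global existence -/

/-- Along a classical trajectory in the regular set, `Q` has derivative at most zero. -/
theorem hasDerivAt_Q_comp {t : ℝ} {c : ℝ} (hx : y t ∈ regular)
    (hy : HasDerivAt y (c • closedLoop γ v (y t)) t) :
    HasDerivAt (fun s => Q (y s)) (-(c * γ * ‖gradOmega (y t)‖)) t := by
  obtain ⟨Q', hQ, hω⟩ := hasFDerivAt_Q (y t) hx.1 hx.2
  refine (hQ.comp_hasDerivAt t hy).congr_deriv ?_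
  rw [map_smul, closedLoop, hω, omega_feedback hx, smul_eq_mul]
  ring

theorem antitoneOn_Q (hγ : 0 < γ) (hF : IsSlowdown γ v F) {s : Set ℝ} (hs : Convex ℝ s)
    (hc : ContinuousOn y s) (hr : ∀ t ∈ s, y t ∈ regular)
    (hy : ∀ t ∈ interior s, HasDerivAt y (F (y t)) t) : AntitoneOn (fun t => Q (y t)) s := by
  have hd (t : ℝ) (ht : t ∈ interior s) : ∃ d, d ≤ 0 ∧ HasDerivAt (fun s => Q (y s)) d t := by
    obtain ⟨c, hc, hx⟩ := hF (y t)
    have h1 := hy t ht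
    rw [hx] at h1
    refine ⟨_, ?_, hasDerivAt_Q_comp (hr t (interior_subset ht)) h1⟩
    have := mul_nonneg (mul_nonneg hc.1 hγ.le) (norm_nonneg (gradOmega (y t)))
    linarith
  refine antitoneOn_of_deriv_nonpos hs (continuous_Q.comp_continuousOn hc) (fun t ht => ?_)
    fun t ht => ?_
  · obtain ⟨d, -, h⟩ := hd t ht
    exact h.differentiableAt.differentiableWithinAt
  · obtain ⟨d, h0, h⟩ := hd t ht
    rw [h.deriv]
    exact h0

/-- A compactly supported `C¹` slowdown of the closed-loop field that agrees with it on `K`. -/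
theorem exists_lipschitz_slowdown (γ : ℝ) (v : ℝ → Control) {K : Set State} (hK : IsCompact K)
    (hKr : K ⊆ regular) : ∃ F : State → State, IsSlowdown γ v F ∧ (∃ C, LipschitzWith C F) ∧
      (∃ L : NNReal, ∀ x, ‖F x‖ ≤ L) ∧ EqOn F (closedLoop γ v) K := by
  obtain ⟨K', hK', hKK', hK'r⟩ := exists_compact_between hK isOpen_regular hKr
  obtain ⟨φ, h1, h0, hφ⟩ := exists_contMDiffMap_one_nhds_of_subset_interior (n := 1)
    (modelWithCornersSelf ℝ State) hK.isClosed hKK'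
  have hφd : ContDiff ℝ 1 φ := φ.contMDiff.contDiff
  set F : State → State := fun x => φ x • closedLoop γ v x with hFdef
  have hF0 (x : State) (hx : x ∉ K') : F x = 0 := by simp [hFdef, h0 x hx]
  have hsupp : HasCompactSupport F := HasCompactSupport.intro hK' hF0
  have hFd : ContDiff ℝ 1 F := by
    rw [contDiff_iff_contDiffAt]
    intro x
    by_cases hx : x ∈ K'
    · exact hφd.contDiffAt.smul (contDiffAt_closedLoop (hK'r hx))
    · refine (contDiffAt_const (c := (0 : State))).congr_of_eventuallyEq ?_
      filter_upwards [hK'.isClosed.isOpen_compl.mem_nhds hx] with z hz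
      exact hF0 z hz
  obtain ⟨L, hL⟩ := hsupp.exists_bound_of_continuous hFd.continuous
  refine ⟨F, fun x => ⟨φ x, hφ x, rfl⟩,
    ContDiff.lipschitzWith_of_hasCompactSupport hsupp hFd one_ne_zero,
    ⟨L.toNNReal, fun x => (hL x).trans (Real.le_coe_toNNReal L)⟩, fun x hx => ?_⟩
  have : φ x = 1 := h1.self_of_nhdsSet x hx
  simp [hFdef, this]

theorem continuousOn_closedLoop : ContinuousOn (closedLoop γ v) regular :=
  fun _ hx => (contDiffAt_closedLoop hx).continuousAt.continuousWithinAt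

/-- In the region of smoothness, absolutely continuous solutions are classical. -/
theorem IsTraj.hasDerivWithinAt (hab : a ≤ b) (hy : IsTraj (closedLoop γ v) y a b)
    (hr : ∀ t ∈ Icc a b, y t ∈ regular) :
    ∀ t ∈ Icc a b, HasDerivWithinAt y (closedLoop γ v (y t)) (Icc a b) t := by
  have hc : ContinuousOn (fun t => closedLoop γ v (y t)) (Icc a b) :=
    continuousOn_closedLoop.comp (hy.continuousOn hab) hr
  set g : ℝ → State := IccExtend hab ((Icc a b).domRestrict fun t => closedLoop γ v (y t)) with hg
  have hgc : Continuous g := hc.domRestrict.Icc_extend'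
  have hge (t : ℝ) (ht : t ∈ Icc a b) : g t = closedLoop γ v (y t) := by
    rw [hg, IccExtend_of_mem hab _ ht, domRestrict_apply]
  -- The difference between `y` and the primitive of its continuous right-hand side is absolutely
  -- continuous with zero derivative almost everywhere, hence constant.
  set I : ℝ → State := fun t => ∫ s in a..t, g s with hI
  have hId (t : ℝ) : HasDerivAt I (g t) t := (hgc.integral_hasStrictDerivAt a t).hasDerivAt
  have hIac : AbsolutelyContinuousOnInterval I a b := by
    refine ContDiffOn.absolutelyContinuousOnInterval (ContDiff.contDiffOn ?_)
    rw [contDiff_one_iff_deriv]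
    refine ⟨fun t => (hId t).differentiableAt, ?_⟩
    rwa [show deriv I = g from funext fun t => (hId t).deriv]
  obtain ⟨C, hC⟩ := (hy.1.sub hIac).const_of_ae_hasDerivAt_zero (by
    rw [uIcc_of_le hab]
    filter_upwards [hy.2, ae_mem_Ioo_of_mem_Icc a b] with t h1 h2 h3
    have := (h1 (h2 h3)).sub (hId t)
    rwa [hge t h3, sub_self] at this)
  rw [uIcc_of_le hab] at hC
  have heq (t : ℝ) (ht : t ∈ Icc a b) : y t = C + I t := by
    rw [← hC t ht, Pi.sub_apply, sub_add_cancel]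
  intro t ht
  rw [← hge t ht]
  exact ((hId t).hasDerivWithinAt.const_add C).congr heq (heq t ht)

theorem IsTraj.forall_mem_regular (hγ : 0 < γ) (hy : IsTraj (closedLoop γ v) y a b)
    (ha : y a ∈ regular) : ∀ t ∈ Icc a b, y t ∈ regular := fun _ ht =>
  ((hy.mono le_rfl ht.1 ht.2).mem_regular isSlowdown_closedLoop hγ ht.1 ha).2

/-- Uniqueness of absolutely continuous solutions that start in the region of smoothness. -/
theorem IsTraj.eqOn (hγ : 0 < γ) (hab : a ≤ b) {y z : ℝ → State}
    (hy : IsTraj (closedLoop γ v) y a b) (hz : IsTraj (closedLoop γ v) z a b)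
    (ha : y a ∈ regular) (hyz : y a = z a) : EqOn y z (Icc a b) := by
  have hyr := hy.forall_mem_regular hγ ha
  have hzr := hz.forall_mem_regular hγ (hyz ▸ ha)
  have hyc := hy.continuousOn hab
  have hzc := hz.continuousOn hab
  -- Cutting off outside the union of the two compact orbits makes the field globally Lipschitz
  -- without changing it along either solution.
  obtain ⟨F, -, ⟨C, hC⟩, -, hF⟩ := exists_lipschitz_slowdown γ v
    ((isCompact_Icc.image_of_continuousOn hyc).union (isCompact_Icc.image_of_continuousOn hzc))
    (union_subset (image_subset_iff.2 hyr) (image_subset_iff.2 hzr))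
  have key (w : ℝ → State) (hw : ∀ t ∈ Icc a b,
      HasDerivWithinAt w (closedLoop γ v (w t)) (Icc a b) t)
      (hwF : ∀ t ∈ Icc a b, F (w t) = closedLoop γ v (w t)) (t : ℝ) (ht : t ∈ Ico a b) :
      HasDerivWithinAt w (F (w t)) (Ici t) t := by
    have htI := Ico_subset_Icc_self ht
    rw [hwF t htI]
    exact (hw t htI).mono_of_mem_nhdsWithin (Icc_mem_nhdsGE_of_mem ht)
  exact ODE_solution_unique_of_mem_Icc_right (v := fun _ => F) (s := fun _ => univ) (K := C)
    (fun _ _ => hC.lipschitzOnWith) hyc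
    (key y (hy.hasDerivWithinAt hab hyr) fun t ht => hF (.inl (mem_image_of_mem y ht)))
    (fun _ _ => mem_univ _) hzc
    (key z (hz.hasDerivWithinAt hab hzr) fun t ht => hF (.inr (mem_image_of_mem z ht)))
    (fun _ _ => mem_univ _) hyz

theorem exists_hasDerivWithinAt_of_lipschitz {E : Type*} [NormedAddCommGroup E] [NormedSpace ℝ E]
    [CompleteSpace E] {F : E → E} {C L : NNReal} (hC : LipschitzWith C F) (hL : ∀ x, ‖F x‖ ≤ L)
    (x₀ : E) {T : ℝ} (hT : 0 ≤ T) : ∃ y : ℝ → E, y 0 = x₀ ∧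
      ∀ t ∈ Icc 0 T, HasDerivWithinAt y (F (y t)) (Icc 0 T) t := by
  have h : IsPicardLindelof (fun _ => F) (tmin := 0) (tmax := T) ⟨0, le_rfl, hT⟩ x₀
      (L * T.toNNReal) 0 L C :=
    { lipschitzOnWith := fun _ _ => hC.lipschitzOnWith
      continuousOn := fun _ _ => continuousOn_const
      norm_le := fun _ _ x _ => hL x
      mul_max_le := by simp [hT] }
  exact h.exists_eq_forall_mem_Icc_hasDerivWithinAt₀

/-- The set `K` is cut out by the a priori bounds on `|x₃|`, `σ` and `Q` over `[0, T]`. These bounds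
hold for every slowdown, so the trajectory of the field cut off outside `K` never leaves `K` and
solves the original equation. -/
theorem exists_isTraj (hγ : 0 < γ) (v : ℝ → Control) {x₀ : State} (hx : x₀ ∈ regular) {T : ℝ}
    (hT : 0 ≤ T) : ∃ y : ℝ → State, y 0 = x₀ ∧ IsTraj (closedLoop γ v) y 0 T := by
  set m₁ := |x₀ 2| * Real.exp (-(2 * γ * (T - 0))) with hm₁
  set m₂ := min (sigma x₀) m₁ with hm₂
  have hm₁pos : 0 < m₁ := mul_pos (abs_pos.2 hx.2) (Real.exp_pos _)
  have hm₂pos : 0 < m₂ := lt_min (sigma_pos_of_regular hx) hm₁pos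
  set K : Set State := {x | m₁ ≤ |x 2| ∧ m₂ ≤ sigma x ∧ Q x ≤ Q x₀} with hK
  have hKc : IsCompact K := by
    refine Metric.isCompact_of_isClosed_isBounded ?_ ?_
    · have h2 : Continuous fun x : State => |x 2| := by fun_prop
      exact (isClosed_le continuous_const h2).inter
        ((isClosed_le continuous_const continuous_sigma).inter
          (isClosed_le continuous_Q continuous_const))
    · refine isBounded_iff_forall_norm_le.2 ⟨Real.sqrt (3 * Q x₀), fun x hx => ?_⟩
      exact Real.le_sqrt_of_sq_le ((norm_sq_le_Q x).trans (by linarith [hx.2.2]))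
  have hKr : K ⊆ regular := fun x hx =>
    ⟨(hm₂pos.trans_le hx.2.1).ne', abs_pos.1 (hm₁pos.trans_le hx.1)⟩
  obtain ⟨F, hF, ⟨C, hC⟩, ⟨L, hL⟩, hFK⟩ := exists_lipschitz_slowdown γ v hKc hKr
  obtain ⟨y, hy0, hy⟩ := exists_hasDerivWithinAt_of_lipschitz hC hL x₀ hT
  have hyc : ContinuousOn y (Icc 0 T) := fun t ht => (hy t ht).continuousWithinAt
  have htraj : IsTraj F y 0 T :=
    isTraj_of_hasDerivWithinAt hT hy (hC.continuous.comp_continuousOn hyc)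
  have hreg (t : ℝ) (ht : t ∈ Icc 0 T) :=
    (htraj.mono le_rfl ht.1 ht.2).mem_regular hF hγ ht.1 (hy0 ▸ hx)
  have hQ := antitoneOn_Q hγ hF (convex_Icc 0 T) hyc (fun t ht => (hreg t ht).2) fun t ht => by
    rw [interior_Icc] at ht
    exact (hy t (Ioo_subset_Icc_self ht)).hasDerivAt (Icc_mem_nhds ht.1 ht.2)
  have hmem (t : ℝ) (ht : t ∈ Icc 0 T) : y t ∈ K := by
    have hle : m₁ ≤ |x₀ 2| * Real.exp (-(2 * γ * (t - 0))) := by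
      rw [hm₁]; gcongr; exact ht.2
    have hz := (htraj.mono le_rfl ht.1 ht.2).abs_vertical_ge hF hγ ht.1
    have hs := (hreg t ht).1
    rw [hy0] at hz hs
    refine ⟨hle.trans hz, (min_le_min_left _ hle).trans hs, ?_⟩
    rw [← hy0]
    exact hQ ⟨le_rfl, hT⟩ ht ht.1
  refine ⟨y, hy0, htraj.1, ?_⟩
  filter_upwards [htraj.2] with t h1 h2
  rw [← hFK (hmem t (Ioo_subset_Icc_self h2))]
  exact h1 h2

/-- Global existence in the region of smoothness. -/
theorem exists_global_solution (hγ : 0 < γ) (v : ℝ → Control) {x₀ : State} (hx : x₀ ∈ regular) :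
    ∃ x : ℝ → State, x 0 = x₀ ∧ (∀ t, 0 ≤ t → x t ∈ regular) ∧
      ∀ t ∈ Ici (0 : ℝ), HasDerivWithinAt x (closedLoop γ v (x t)) (Ici 0) t := by
  have hex (n : ℝ) : ∃ y : ℝ → State, y 0 = x₀ ∧ (0 ≤ n → IsTraj (closedLoop γ v) y 0 n) := by
    rcases le_or_gt 0 n with hn | hn
    · obtain ⟨y, h0, h⟩ := exists_isTraj hγ v hx hn
      exact ⟨y, h0, fun _ => h⟩
    · exact ⟨fun _ => x₀, rfl, fun h => absurd h (not_le.2 hn)⟩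
  choose X hX0 hX using hex
  have hcomp {t n m : ℝ} (ht : 0 ≤ t) (hn : t ≤ n) (hm : t ≤ m) : X n t = X m t :=
    IsTraj.eqOn hγ ht ((hX n (ht.trans hn)).mono le_rfl ht hn)
      ((hX m (ht.trans hm)).mono le_rfl ht hm) (by rw [hX0]; exact hx) (by rw [hX0, hX0])
      ⟨ht, le_rfl⟩
  have hreg {t n : ℝ} (ht : 0 ≤ t) (hn : t ≤ n) : X n t ∈ regular :=
    (hX n (ht.trans hn)).forall_mem_regular hγ (by rw [hX0]; exact hx) t ⟨ht, hn⟩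
  -- The value at `t` is read off the solution on `[0, t]`. By uniqueness this agrees on `[0, t +
  -- 1]` with the single solution `X (t + 1)`, which supplies the derivative at `t`.
  refine ⟨fun t => X t t, hX0 0, fun t ht => hreg ht le_rfl, fun t ht => ?_⟩
  have ht0 : (0 : ℝ) ≤ t := ht
  have hn : (0 : ℝ) ≤ t + 1 := by linarith
  have hd := (hX (t + 1) hn).hasDerivWithinAt hn (fun s hs => hreg hs.1 hs.2) t
    ⟨ht0, by linarith⟩
  have hmem : Icc 0 (t + 1) ∈ 𝓝[Ici 0] t := by
    rw [← Ici_inter_Iic]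
    exact inter_mem self_mem_nhdsWithin (mem_nhdsWithin_of_mem_nhds (Iic_mem_nhds (by linarith)))
  have heq : X t t = X (t + 1) t := hcomp ht0 le_rfl (by linarith)
  simp only [heq]
  refine (hd.mono_of_mem_nhdsWithin hmem).congr_of_eventuallyEq ?_ heq
  filter_upwards [hmem] with s hs
  exact hcomp hs.1 le_rfl hs.2

/-! ### Convergence to the origin -/

section Convergence

theorem exists_lt_of_linear_decay {g : ℝ → ℝ} {a c ε : ℝ} (hc : 0 < c)
    (h : (∀ t, a ≤ t → ε ≤ g t) → ∀ t, a ≤ t → g t ≤ g a - c * (t - a)) :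
    ∃ t, a ≤ t ∧ g t < ε := by
  by_contra! hn
  -- At this time the linear bound gives `g ≤ ε - 1`.
  have hle : a ≤ a + (g a - ε + 1) / c := by
    have := hn a le_rfl
    have : 0 ≤ (g a - ε + 1) / c := div_nonneg (by linarith) hc.le
    linarith
  have h1 := h hn _ hle
  have h2 := hn _ hle
  have h3 : c * (a + (g a - ε + 1) / c - a) = g a - ε + 1 := by field_simp; ring
  linarith

theorem tendsto_Q_of_antitoneOn (hQ : AntitoneOn (fun t => Q (y t)) (Ici a))
    (hε : ∀ ε > 0, ∃ t, a ≤ t ∧ Q (y t) < ε) : Tendsto (fun t => Q (y t)) atTop (𝓝 0) := by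
  rw [Metric.tendsto_atTop]
  intro ε he
  obtain ⟨t, ht, hlt⟩ := hε ε he
  refine ⟨t, fun s hs => ?_⟩
  rw [Real.dist_eq, sub_zero, abs_of_nonneg (Q_nonneg _)]
  exact (hQ ht (ht.trans hs) hs).trans_lt hlt

theorem tendsto_zero_of_tendsto_Q (h : Tendsto (fun t => Q (y t)) atTop (𝓝 0)) :
    Tendsto y atTop (𝓝 0) := by
  rw [tendsto_zero_iff_norm_tendsto_zero]
  have h1 : Tendsto (fun t => Real.sqrt (3 * Q (y t))) atTop (𝓝 0) := by
    simpa using (h.const_mul 3).sqrt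
  exact squeeze_zero (fun _ => norm_nonneg _)
    (fun t => Real.le_sqrt_of_sq_le (norm_sq_le_Q (y t))) h1

/-- The shell is compact and misses the origin, so `gradSq` has a positive minimum on it. The
minimum is taken of `gradSq`, which is continuous everywhere, since the shell also meets the plane
and the axis. -/
theorem exists_le_norm_gradOmega {ε R : ℝ} (hε : 0 < ε) :
    ∃ c > 0, ∀ x ∈ regular, ε ≤ Q x → Q x ≤ R → c ≤ ‖gradOmega x‖ := by
  set K : Set State := {x | ε ≤ Q x ∧ Q x ≤ R}
  have hKc : IsCompact K := by
    refine Metric.isCompact_of_isClosed_isBounded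
      ((isClosed_le continuous_const continuous_Q).inter
        (isClosed_le continuous_Q continuous_const)) ?_
    refine isBounded_iff_forall_norm_le.2 ⟨Real.sqrt (3 * R), fun x hx => ?_⟩
    exact Real.le_sqrt_of_sq_le ((norm_sq_le_Q x).trans (by linarith [hx.2]))
  rcases K.eq_empty_or_nonempty with hK | hK
  · refine ⟨1, one_pos, fun x _ h1 h2 => ?_⟩
    have : x ∈ K := ⟨h1, h2⟩
    simp [hK] at this
  obtain ⟨p, hp, hmin⟩ := hKc.exists_isMinOn hK continuous_gradSq.continuousOn
  have hp0 : p ≠ 0 := by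
    rintro rfl
    have := hp.1
    simp [Q, sigma] at this
    linarith
  refine ⟨Real.sqrt (4 * gradSq p), Real.sqrt_pos.2 (by linarith [gradSq_pos hp0]),
    fun x hx h1 h2 => ?_⟩
  refine Real.sqrt_le_iff.2 ⟨norm_nonneg _, ?_⟩
  have : gradSq p ≤ gradSq x := hmin (show x ∈ K from ⟨h1, h2⟩)
  rw [norm_sq_gradOmega hx]
  linarith

theorem attraction_of_regular (hγ : 0 < γ)
    (hy : ∀ b, a ≤ b → IsTraj (closedLoop γ v) y a b) (ha : y a ∈ regular) :
    AntitoneOn (fun t => Q (y t)) (Ici a) ∧ ∀ ε > 0, ∃ t, a ≤ t ∧ Q (y t) < ε := by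
  have hr (t : ℝ) (ht : a ≤ t) : y t ∈ regular :=
    (hy t ht).forall_mem_regular hγ ha t ⟨ht, le_rfl⟩
  have hd (t : ℝ) (ht : a < t) : HasDerivAt y (closedLoop γ v (y t)) t := by
    have hle : a ≤ t + 1 := by linarith
    exact ((hy _ hle).hasDerivWithinAt hle (fun s hs => hr s hs.1) t
      ⟨ht.le, by linarith⟩).hasDerivAt (Icc_mem_nhds ht (by linarith))
  have hc : ContinuousOn y (Ici a) := by
    intro t ht
    rcases (mem_Ici.1 ht).eq_or_lt with rfl | h
    · exact ((hy (a + 1) (by linarith)).continuousOn (by linarith) a ⟨le_rfl, by linarith⟩)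
        |>.mono_of_mem_nhdsWithin (Icc_mem_nhdsGE (by linarith))
    · exact (hd t h).continuousAt.continuousWithinAt
  have hQ : AntitoneOn (fun t => Q (y t)) (Ici a) :=
    antitoneOn_Q hγ isSlowdown_closedLoop (convex_Ici a) hc hr fun t ht => by
      rw [interior_Ici] at ht
      exact hd t ht
  refine ⟨hQ, fun ε hε => ?_⟩
  obtain ⟨c, hc0, hcle⟩ := exists_le_norm_gradOmega (R := Q (y a)) hε
  refine exists_lt_of_linear_decay (c := γ * c) (by positivity) fun hle t ht => ?_
  have hQd (s : ℝ) (hs : a < s) : HasDerivAt (fun s => Q (y s)) (-(1 * γ * ‖gradOmega (y s)‖)) s :=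
    hasDerivAt_Q_comp (hr s hs.le) (by rw [one_smul]; exact hd s hs)
  have h := (convex_Ici a).image_sub_le_mul_sub_of_deriv_le (f := fun s => Q (y s))
    (continuous_Q.comp_continuousOn hc) (C := -(γ * c))
    (fun s hs => by
      rw [interior_Ici] at hs
      exact (hQd s hs).differentiableAt.differentiableWithinAt)
    (fun s hs => by
      rw [interior_Ici] at hs
      have hs' : a < s := hs
      rw [(hQd s hs).deriv]
      have := mul_le_mul_of_nonneg_left
        (hcle (y s) (hr s hs'.le) (hle s hs'.le) (hQ self_mem_Ici hs'.le hs'.le)) hγ.le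
      linarith) a self_mem_Ici t ht ht
  linarith

/-- Here `Q = σ²` has derivative `-2γσ` almost everywhere. The rate `c` in `key` is `0` for
monotonicity and `2γ√ε` while `Q ≥ ε`. -/
theorem attraction_of_plane (hγ : 0 < γ)
    (hy : ∀ b, a ≤ b → IsTraj (closedLoop γ v) y a b) (h2 : ∀ t, a ≤ t → y t 2 = 0) :
    AntitoneOn (fun t => Q (y t)) (Ici a) ∧ ∀ ε > 0, ∃ t, a ≤ t ∧ Q (y t) < ε := by
  have hQ (t : ℝ) (ht : a ≤ t) : Q (y t) = sigma (y t) ^ 2 := by simp [Q, h2 t ht]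
  have key {s t c : ℝ} (hs : a ≤ s) (hst : s ≤ t)
      (hle : ∀ r, a ≤ r → c ≤ 2 * γ * sigma (y r)) :
      sigma (y t) ^ 2 ≤ sigma (y s) ^ 2 - c * (t - s) := by
    have htr := (hy t (hs.trans hst)).mono hs hst le_rfl
    have hlin : AbsolutelyContinuousOnInterval (fun r : ℝ => c * r) s t :=
      ContDiffOn.absolutelyContinuousOnInterval (by fun_prop)
    have := le_of_ae_hasDerivAt_nonneg hst
      ((absolutelyContinuousOnInterval_sigma_sq htr.1).fun_add hlin).fun_neg (by
        filter_upwards [htr.2] with r h1 h3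
        refine ⟨_, ?_, ((hasDerivAt_sigma_sq (h1 h3)).add ((hasDerivAt_id r).const_mul c)).neg⟩
        have hr : a ≤ r := hs.trans h3.1.le
        have h4 := radial_feedback_of_plane (γ := γ) (v := v) (h2 r hr)
        have h5 := hle r hr
        rw [closedLoop_apply_zero, closedLoop_apply_one, h4]
        linarith)
    linarith
  constructor
  · intro s hs t ht hst
    simp only [hQ s hs, hQ t ht]
    have := key (c := 0) hs hst fun r _ => by
      have := sigma_nonneg (y r)
      positivity
    linarith
  · intro ε hε
    refine exists_lt_of_linear_decay (c := 2 * γ * Real.sqrt ε)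
      (by have := Real.sqrt_pos.2 hε; positivity) fun hle t ht => ?_
    rw [hQ t ht, hQ a le_rfl]
    refine key le_rfl ht fun r hr => ?_
    have h := hle r hr
    rw [hQ r hr] at h
    have := Real.sqrt_le_iff.2 ⟨sigma_nonneg (y r), h⟩
    gcongr

/-- Every absolutely continuous solution starting off the exceptional set avoids it, is bounded
and tends to the origin. -/
theorem IsSolution.attraction (hγ : 0 < γ) (hv : ∀ s : ℝ, s ≠ 0 → ‖v s‖ = 1)
    (hy : IsSolution (closedLoop γ v) y) (h0 : y 0 ∉ exceptional) :
    (∀ t : ℝ, 0 ≤ t → y t ∉ exceptional) ∧ (∃ R : ℝ, ∀ t : ℝ, 0 ≤ t → ‖y t‖ ≤ R) ∧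
      Tendsto (fun t => Q (y t)) atTop (𝓝 0) ∧ Tendsto y atTop (𝓝 0) := by
  have hex (t : ℝ) (ht : 0 ≤ t) : y t ∉ exceptional :=
    (hy.isTraj le_rfl ht).notMem_exceptional hγ hv ht h0
  obtain ⟨a, ha, hQ, hε⟩ : ∃ a, 0 ≤ a ∧ AntitoneOn (fun t => Q (y t)) (Ici a) ∧
      ∀ ε > 0, ∃ t, a ≤ t ∧ Q (y t) < ε := by
    -- A solution may leave the plane after a while. From any time `a` with `x₃ ≠ 0` it lies in
    -- `regular`, and only its tail matters for the limit.
    by_cases h : ∀ t, 0 ≤ t → y t 2 = 0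
    · exact ⟨0, le_rfl, attraction_of_plane hγ (fun b hb => hy.isTraj le_rfl hb) h⟩
    · push Not at h
      obtain ⟨a, ha, hz⟩ := h
      exact ⟨a, ha, attraction_of_regular hγ (fun b hb => hy.isTraj ha hb)
        (mem_regular_of_notMem_exceptional (hex a ha) hz)⟩
  have hT := tendsto_Q_of_antitoneOn hQ hε
  refine ⟨hex, ?_, hT, tendsto_zero_of_tendsto_Q hT⟩
  obtain ⟨R, hR⟩ :=
    isCompact_Icc.exists_bound_of_continuousOn ((hy.isTraj le_rfl ha).continuousOn ha)
  refine ⟨max R (Real.sqrt (3 * Q (y a))), fun t ht => ?_⟩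
  rcases le_total t a with h | h
  · exact (hR t ⟨ht, h⟩).trans (le_max_left _ _)
  · refine le_trans (Real.le_sqrt_of_sq_le ((norm_sq_le_Q (y t)).trans ?_)) (le_max_right _ _)
    have := hQ self_mem_Ici h h
    simp only at this
    linarith

end Convergence

/-! ### Rigidity of classical solutions at the origin and in the plane -/

section Classical

theorem Icc_subset_timeInterval {τ : EReal} {t : ℝ} (ht : t ∈ timeInterval τ) :
    Icc 0 t ⊆ timeInterval τ := fun _ hs =>
  ⟨hs.1, (EReal.coe_le_coe_iff.2 hs.2).trans_lt ht.2⟩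

theorem isPreconnected_timeInterval (τ : EReal) : IsPreconnected (timeInterval τ) := by
  refine OrdConnected.isPreconnected ⟨fun s hs t ht r hr => ?_⟩
  exact Icc_subset_timeInterval ht ⟨hs.1.trans hr.1, hr.2⟩

theorem IsClassicalSolutionOn.isTraj {F : State → State} {I : Set ℝ}
    (hy : IsClassicalSolutionOn F y I) (hab : a ≤ b) (h : Icc a b ⊆ I) : IsTraj F y a b :=
  isTraj_of_hasDerivWithinAt hab (fun t ht => (hy.1 t (h ht)).mono h) (hy.2.mono h)

/-- A classical solution is either always or never at the origin. -/
theorem IsClassicalSolutionOn.eq_zero_iff (hγ : 0 < γ) (hv : ∀ s : ℝ, s ≠ 0 → ‖v s‖ = 1)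
    {I : Set ℝ} (hI : IsPreconnected I) (hy : IsClassicalSolutionOn (closedLoop γ v) y I)
    {s t : ℝ} (hs : s ∈ I) (ht : t ∈ I) (h : y s = 0) : y t = 0 := by
  by_contra hn
  have hc : ContinuousOn (fun t => closedLoop γ v (y t) 0 ^ 2 + closedLoop γ v (y t) 1 ^ 2) I := by
    have h1 : Continuous fun x : State => x 0 ^ 2 + x 1 ^ 2 := by fun_prop
    exact h1.comp_continuousOn hy.2
  have h0 : closedLoop γ v (y s) 0 ^ 2 + closedLoop γ v (y s) 1 ^ 2 = 0 := by
    simp [h, closedLoop_zero]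
  -- The continuous function `|u|²` takes only the values `0` and `γ²`, so it cannot pass through
  -- `γ²/2`.
  obtain ⟨r, hr, hval⟩ := hI.intermediate_value hs ht hc (show γ ^ 2 / 2 ∈ _ by
    rw [h0, closedLoop_sq_add_sq hγ hv hn]
    constructor <;> nlinarith)
  simp only at hval
  by_cases hz : y r = 0
  · simp only [hz, closedLoop_zero, PiLp.zero_apply] at hval
    nlinarith
  · rw [closedLoop_sq_add_sq hγ hv hz] at hval
    nlinarith

/-- Squaring removes the sign of `x₃`, and clearing the denominator leaves factors that can be
followed to the plane, where the feedback formula changes. -/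
theorem vertical_feedback_sq {x : State} (hx : x ∈ regular) :
    closedLoop γ v x 2 ^ 2 * gradSq x = γ ^ 2 * (sigma x ^ 4 * (2 * |x 2| - sigma x) ^ 2) := by
  have hn := norm_gradOmega_pos hx
  have hsq := norm_sq_gradOmega hx
  have hz : Real.sign (x 2) ^ 2 = 1 := by
    rcases lt_or_gt_of_ne hx.2 with h | h
    · simp [Real.sign_of_neg h]
    · simp [Real.sign_of_pos h]
  have hg : gradSq x = ‖gradOmega x‖ ^ 2 / 4 := by linarith
  rw [closedLoop_apply_two, vertical_feedback_of_regular hx, hg]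
  field_simp
  linear_combination 4 * γ ^ 2 * sigma x ^ 4 * (2 * |x 2| - sigma x) ^ 2 * hz

/-- Classical solutions that avoid the origin cannot leave the plane `x₃ = 0`. -/
theorem IsClassicalSolutionOn.vertical_eq_zero (hγ : 0 < γ)
    (hy : IsClassicalSolutionOn (closedLoop γ v) y (Icc a b)) (hab : a ≤ b)
    (hne : ∀ t ∈ Icc a b, y t ≠ 0) (ha : y a 2 = 0) : y b 2 = 0 := by
  by_contra hb
  have hyc := (hy.isTraj hab Subset.rfl).continuousOn hab
  have hzc : ContinuousOn (fun t => y t 2) (Icc a b) := by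
    have h1 : Continuous fun x : State => x 2 := by fun_prop
    exact h1.comp_continuousOn hyc
  have hcl : IsClosed (Icc a b ∩ (fun t => y t 2) ⁻¹' {0}) :=
    hzc.preimage_isClosed_of_isClosed isClosed_Icc isClosed_singleton
  obtain ⟨c, ⟨hcI, hcz⟩, hmax⟩ := (isCompact_Icc.of_isClosed_subset hcl
    inter_subset_left).exists_isGreatest ⟨a, ⟨le_rfl, hab⟩, ha⟩
  have hcz' : y c 2 = 0 := hcz
  have hcb : c < b := hcI.2.lt_of_ne (by rintro rfl; exact hb hcz)
  have hσ : sigma (y c) ≠ 0 := fun h => hne c hcI ((Brockett.eq_zero_iff _).2 ⟨h, hcz⟩)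
  have hsub : Ioc c b ⊆ Icc a b := fun t ht => ⟨hcI.1.trans ht.1.le, ht.2⟩
  have hyt : Tendsto y (𝓝[Ioc c b] c) (𝓝 (y c)) := (hyc c hcI).mono hsub
  have hft : Tendsto (fun t => closedLoop γ v (y t)) (𝓝[Ioc c b] c) (𝓝 (closedLoop γ v (y c))) :=
    (hy.2 c hcI).mono hsub
  have happ : Continuous fun x : State => x 2 := by fun_prop
  have hL : Tendsto (fun t => closedLoop γ v (y t) 2 ^ 2 * gradSq (y t)) (𝓝[Ioc c b] c)
      (𝓝 (closedLoop γ v (y c) 2 ^ 2 * gradSq (y c))) :=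
    (((happ.tendsto _).comp hft).pow 2).mul ((continuous_gradSq.tendsto _).comp hyt)
  have hRc : Continuous fun x : State => γ ^ 2 * (sigma x ^ 4 * (2 * |x 2| - sigma x) ^ 2) := by
    have := continuous_sigma
    fun_prop
  have hR := (hRc.tendsto _).comp hyt
  have hev : (fun t => closedLoop γ v (y t) 2 ^ 2 * gradSq (y t)) =ᶠ[𝓝[Ioc c b] c]
      (fun x : State => γ ^ 2 * (sigma x ^ 4 * (2 * |x 2| - sigma x) ^ 2)) ∘ y := by
    filter_upwards [self_mem_nhdsWithin,
      ((continuous_sigma.tendsto _).comp hyt).eventually_ne hσ] with t ht hs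
    refine vertical_feedback_sq ⟨hs, fun h0 => ?_⟩
    exact absurd (hmax ⟨hsub ht, h0⟩) (not_le.2 ht.1)
  have : (𝓝[Ioc c b] c).NeBot := by
    rw [nhdsWithin_Ioc_eq_nhdsGT hcb]; infer_instance
  -- Let `t` decrease to the last time `c` in the plane. The left side of `vertical_feedback_sq`
  -- tends to `0`, since `ẋ₃ = 0` at `c`, but the right side tends to `γ²σ⁶ > 0`.
  have h := tendsto_nhds_unique (hL.congr' hev) hR
  rw [closedLoop_apply_two, vertical_feedback_of_plane hcz', hcz'] at h
  have hσ4 : 0 < γ ^ 2 * (sigma (y c) ^ 4 * (2 * |0| - sigma (y c)) ^ 2) := by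
    have : 0 < (2 * |0| - sigma (y c)) ^ 2 := by
      rw [abs_zero, mul_zero, zero_sub, neg_sq]; positivity
    positivity
  simp only [ne_eq, OfNat.ofNat_ne_zero, not_false_eq_true, zero_pow, zero_mul] at h
  exact hσ4.ne h

/-- Cauchy–Schwarz for the unit vector along `(z₁, z₂)`. It makes the planar field `-γx/|x|`
dissipative, so distances between planar solutions do not grow although the field is discontinuous
at the origin. -/
theorem neg_mul_sigma_le (hγ : 0 < γ) {x z : State} (hz : z 2 = 0) :
    -(γ * sigma x) ≤ x 0 * feedback γ v z 0 + x 1 * feedback γ v z 1 := by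
  rw [feedback_of_plane hz]
  simp only [PiLp.smul_apply, smul_eq_mul, Matrix.cons_val_zero, Matrix.cons_val_one]
  by_cases hs : sigma z = 0
  · have := mul_nonneg hγ.le (sigma_nonneg x)
    simp [hs]
    linarith
  have hzpos : 0 < sigma z := (sigma_nonneg z).lt_of_ne' hs
  have hcs : x 0 * z 0 + x 1 * z 1 ≤ sigma x * sigma z := by
    refine abs_le_of_sq_le_sq' ?_ (mul_nonneg (sigma_nonneg _) (sigma_nonneg _)) |>.2
    rw [mul_pow, sigma_sq, sigma_sq]
    nlinarith [sq_nonneg (x 0 * z 1 - x 1 * z 0)]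
  have h1 : (x 0 * z 0 + x 1 * z 1) / sigma z ≤ sigma x := by
    rw [div_le_iff₀ hzpos]; exact hcs
  have h2 := mul_le_mul_of_nonneg_left h1 hγ.le
  have h3 : x 0 * (-γ * (sigma z)⁻¹ * z 0) + x 1 * (-γ * (sigma z)⁻¹ * z 1)
      = -(γ * ((x 0 * z 0 + x 1 * z 1) / sigma z)) := by
    field_simp; ring
  rw [h3]
  linarith

/-- Uniqueness of absolutely continuous solutions within the plane `x₃ = 0`. -/
theorem IsTraj.eqOn_of_plane (hγ : 0 < γ) (hab : a ≤ b) {y z : ℝ → State}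
    (hy : IsTraj (closedLoop γ v) y a b) (hz : IsTraj (closedLoop γ v) z a b)
    (hy2 : ∀ t ∈ Icc a b, y t 2 = 0) (hz2 : ∀ t ∈ Icc a b, z t 2 = 0) (hyz : y a = z a) :
    y b = z b := by
  have h := le_of_ae_hasDerivAt_nonneg hab
    (absolutelyContinuousOnInterval_sigma_sq (hy.1.sub hz.1)).fun_neg (by
      filter_upwards [hy.2, hz.2] with t h1 h2 h3
      refine ⟨_, ?_, (hasDerivAt_sigma_sq ((h1 h3).sub (h2 h3))).neg⟩
      have hyt := hy2 t (Ioo_subset_Icc_self h3)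
      have hzt := hz2 t (Ioo_subset_Icc_self h3)
      have e1 := radial_feedback_of_plane (γ := γ) (v := v) hyt
      have e2 := radial_feedback_of_plane (γ := γ) (v := v) hzt
      have e3 := neg_mul_sigma_le (v := v) hγ (x := y t) hzt
      have e4 := neg_mul_sigma_le (v := v) hγ (x := z t) hyt
      simp only [PiLp.sub_apply, Pi.sub_apply, closedLoop_apply_zero, closedLoop_apply_one]
      linarith)
  have h0 : sigma ((y - z) a) = 0 := by simp [hyz, sigma]
  rw [h0] at h
  have hs : sigma ((y - z) b) = 0 := by nlinarith [sq_nonneg (sigma ((y - z) b))]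
  have : (y - z) b = 0 := (Brockett.eq_zero_iff _).2 ⟨hs, by
    simp [hy2 b ⟨hab, le_rfl⟩, hz2 b ⟨hab, le_rfl⟩]⟩
  exact sub_eq_zero.1 this

end Classical

/-! ### Construction of the maximal classical solution -/

variable {x₀ : State}

/-- The function `x` starts at `x₀`, is a solution that is classical except at `t₀`, reaches the
origin exactly at `t₀`, does not switch before, and is the unique maximal classical solution. -/
def IsClassicalUntil (γ : ℝ) (v : ℝ → Control) (x₀ : State) (t₀ : EReal) (x : ℝ → State) : Prop :=
  0 < t₀ ∧ x 0 = x₀ ∧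
  IsSolution (closedLoop γ v) x ∧
  IsClassicalSolutionOn (closedLoop γ v) x {t : ℝ | 0 ≤ t ∧ (t : EReal) ≠ t₀} ∧
  (x₀ ≠ 0 → ∀ t ∈ timeInterval t₀, x t ≠ 0) ∧
  (∀ T : ℝ, t₀ = (T : EReal) → Tendsto x (𝓝[<] T) (𝓝 0) ∧ ∀ t : ℝ, T ≤ t → x t = 0) ∧
  (∀ t : ℝ, 0 ≤ t → x t ≠ 0 → sigma (x t) ≠ 0 ∧ (x t 2 = 0 ↔ x₀ 2 = 0)) ∧
  ContinuousOn (fun t => feedback γ v (x t)) {t : ℝ | 0 ≤ t ∧ x t ≠ 0} ∧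
  (∀ (τ : EReal) (y : ℝ → State), y 0 = x₀ →
    IsClassicalSolutionOn (closedLoop γ v) y (timeInterval τ) →
    τ ≤ t₀ ∧ EqOn y x (timeInterval τ)) ∧
  (x₀ 2 ≠ 0 → ∀ y : ℝ → State, IsSolution (closedLoop γ v) y → y 0 = x₀ → EqOn y x (Ici 0))

theorem exists_isClassicalUntil_of_regular (hγ : 0 < γ) (v : ℝ → Control) (hx : x₀ ∈ regular) :
    ∃ t₀ x, IsClassicalUntil γ v x₀ t₀ x := by
  obtain ⟨x, h0, hr, hd⟩ := exists_global_solution hγ v hx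
  have hset : {t : ℝ | 0 ≤ t ∧ (t : EReal) ≠ ⊤} = Ici 0 := by ext t; simp
  have hxc : ContinuousOn x (Ici 0) := fun t ht => (hd t ht).continuousWithinAt
  have hcl : IsClassicalSolutionOn (closedLoop γ v) x (Ici 0) :=
    ⟨hd, continuousOn_closedLoop.comp hxc hr⟩
  have htr (b : ℝ) (hb : 0 ≤ b) : IsTraj (closedLoop γ v) x 0 b := hcl.isTraj hb Icc_subset_Ici_self
  have huniq {b : ℝ} (hb : 0 ≤ b) {y : ℝ → State} (hy : IsTraj (closedLoop γ v) y 0 b)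
      (hy0 : y 0 = x₀) : y b = x b :=
    hy.eqOn hγ hb (htr b hb) (hy0 ▸ hx) (hy0.trans h0.symm) ⟨hb, le_rfl⟩
  refine ⟨⊤, x, EReal.zero_lt_top, h0, ⟨fun T hT => (htr T hT).1, ?_⟩, by rwa [hset],
    fun _ t ht => ne_zero_of_regular (hr t ht.1), fun T hT => absurd hT.symm (EReal.coe_ne_top T),
    fun t ht _ => ⟨(hr t ht).1, by simp [(hr t ht).2, hx.2]⟩, ?_, ?_, ?_⟩
  · have hne : ∀ᵐ t : ℝ, t ≠ 0 := by simp [ae_iff, measure_singleton]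
    filter_upwards [hne] with t ht h
    exact (hd t h).hasDerivAt (Ici_mem_nhds (h.lt_of_ne' ht))
  · have hu : ContinuousOn (feedback γ v) regular := fun x hx =>
      (contDiffAt_feedback hx).continuousAt.continuousWithinAt
    exact (hu.comp hxc hr).mono fun t ht => ht.1
  · exact fun τ y hy0 hy => ⟨le_top, fun t ht =>
      huniq ht.1 (hy.isTraj ht.1 (Icc_subset_timeInterval ht)) hy0⟩
  · exact fun _ y hy hy0 t ht => huniq ht (hy.isTraj le_rfl ht) hy0

theorem isClassicalUntil_zero (hγ : 0 < γ) (hv : ∀ s : ℝ, s ≠ 0 → ‖v s‖ = 1) :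
    IsClassicalUntil γ v 0 ⊤ fun _ => 0 := by
  have hd (s : Set ℝ) (t : ℝ) : HasDerivWithinAt (fun _ : ℝ => (0 : State))
      (closedLoop γ v 0) s t := by
    rw [closedLoop_zero]; exact hasDerivWithinAt_const t s 0
  refine ⟨EReal.zero_lt_top, rfl, ⟨fun T hT => ?_, ?_⟩, ⟨fun t _ => hd _ t, continuousOn_const⟩,
    fun h => absurd rfl h, fun T hT => absurd hT.symm (EReal.coe_ne_top T),
    fun t _ h => absurd rfl h, continuousOn_const, ?_, fun h => absurd (by simp) h⟩
  · exact (isTraj_of_hasDerivWithinAt hT (fun t _ => hd _ t) continuousOn_const).1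
  · exact Eventually.of_forall fun t _ => (hd univ t).hasDerivAt univ_mem
  · refine fun τ y hy0 hy => ⟨le_top, fun t ht => ?_⟩
    exact hy.eq_zero_iff hγ hv (isPreconnected_timeInterval τ)
      (Icc_subset_timeInterval ht ⟨le_rfl, ht.1⟩) ht hy0

theorem feedback_smul_of_plane (h2 : x₀ 2 = 0) {c : ℝ} (hc : 0 < c) :
    feedback γ v (c • x₀) = feedback γ v x₀ := by
  have hs : sigma (c • x₀) = c * sigma x₀ := by
    rw [sigma, show (c • x₀) 0 ^ 2 + (c • x₀) 1 ^ 2 = c ^ 2 * (x₀ 0 ^ 2 + x₀ 1 ^ 2) by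
      simp only [PiLp.smul_apply, smul_eq_mul]; ring, Real.sqrt_mul (sq_nonneg c),
      Real.sqrt_sq hc.le, sigma]
  rw [feedback_of_plane h2, feedback_of_plane (by simp [h2]), hs]
  ext i
  fin_cases i <;> simp <;> field_simp

theorem closedLoop_smul_of_plane (h2 : x₀ 2 = 0) {c : ℝ} (hc : 0 < c) :
    closedLoop γ v (c • x₀) = (-γ / sigma x₀) • x₀ := by
  have hv := vertical_feedback_of_plane (γ := γ) (v := v) h2
  ext i
  fin_cases i
  · simp [feedback_smul_of_plane h2 hc, feedback_of_plane h2, div_eq_mul_inv]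
  · simp [feedback_smul_of_plane h2 hc, feedback_of_plane h2, div_eq_mul_inv]
  · simp only [Fin.reduceFinMk, closedLoop_apply_two, feedback_smul_of_plane h2 hc,
      PiLp.smul_apply, smul_eq_mul, h2, mul_zero]
    linear_combination c * hv

/-- On a ray from the origin in the plane the field is constant, so the solution is `max (1 - t/T) 0
• x₀` with `T = σ(x₀)/γ`, the time to cover the distance `σ(x₀)` at speed `γ`. -/
theorem exists_isClassicalUntil_of_plane (hγ : 0 < γ) (hv : ∀ s : ℝ, s ≠ 0 → ‖v s‖ = 1)
    (h2 : x₀ 2 = 0) (hx : x₀ ≠ 0) : ∃ t₀ x, IsClassicalUntil γ v x₀ t₀ x := by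
  have hs : 0 < sigma x₀ :=
    (sigma_nonneg _).lt_of_ne' fun h => hx ((eq_zero_iff _).2 ⟨h, h2⟩)
  set T : ℝ := sigma x₀ / γ with hTdef
  have hT : 0 < T := div_pos hs hγ
  set ρ : ℝ → ℝ := fun t => max (1 - t / T) 0 with hρ
  have hρpos {t : ℝ} (ht : t < T) : ρ t = 1 - t / T ∧ 0 < ρ t := by
    have : t / T < 1 := (div_lt_one hT).2 ht
    have h1 : ρ t = 1 - t / T := max_eq_left (by linarith)
    exact ⟨h1, by rw [h1]; linarith⟩
  have hρzero {t : ℝ} (ht : T ≤ t) : ρ t = 0 :=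
    max_eq_right (by linarith [(one_le_div hT).2 ht])
  have hρc : Continuous ρ := by fun_prop
  set x : ℝ → State := fun t => ρ t • x₀ with hxdef
  have hxc : Continuous x := hρc.smul continuous_const
  have hxT {t : ℝ} (ht : T ≤ t) : x t = 0 := by simp [hxdef, hρzero ht]
  have hxne {t : ℝ} : x t ≠ 0 ↔ t < T := by
    refine ⟨fun h => ?_, fun h => smul_ne_zero (hρpos h).2.ne' hx⟩
    by_contra! hle
    exact h (hxT hle)
  have hfl {t : ℝ} (ht : t < T) : closedLoop γ v (x t) = (-γ / sigma x₀) • x₀ :=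
    closedLoop_smul_of_plane h2 (hρpos ht).2
  have hfr {t : ℝ} (ht : T ≤ t) : closedLoop γ v (x t) = 0 := by rw [hxT ht, closedLoop_zero]
  have hd {t : ℝ} (ht : t ≠ T) : HasDerivAt x (closedLoop γ v (x t)) t := by
    rcases ht.lt_or_gt with h | h
    · rw [hfl h]
      have hlin : HasDerivAt (fun t : ℝ => (1 - t / T) • x₀) ((-(1 / T)) • x₀) t :=
        (((hasDerivAt_id t).div_const T).const_sub 1).smul_const x₀
      rw [show -γ / sigma x₀ = -(1 / T) by rw [hTdef]; field_simp]
      refine hlin.congr_of_eventuallyEq ?_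
      filter_upwards [Iio_mem_nhds h] with s hs
      simp only [hxdef, (hρpos hs).1]
    · rw [hfr h.le]
      refine (hasDerivAt_const t (0 : State)).congr_of_eventuallyEq ?_
      filter_upwards [Ioi_mem_nhds h] with s hs
      exact hxT (le_of_lt hs)
  have hsol : IsSolution (closedLoop γ v) x := by
    constructor
    · intro b _
      have hlin : AbsolutelyContinuousOnInterval (fun t : ℝ => 1 - t / T) 0 b :=
        ContDiffOn.absolutelyContinuousOnInterval (by fun_prop)
      have hρac : AbsolutelyContinuousOnInterval ρ 0 b :=
        absolutelyContinuousOnInterval_of_dist_le hlin fun s t => by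
          rw [Real.dist_eq, Real.dist_eq]
          exact abs_max_sub_max_le_abs _ _ _
      refine hρac.fun_smul (g := fun _ => x₀) ?_
      exact ContDiffOn.absolutelyContinuousOnInterval contDiffOn_const
    · have hne : ∀ᵐ t : ℝ, t ≠ T := by simp [ae_iff, measure_singleton]
      filter_upwards [hne] with t ht _
      exact hd ht
  have hx0 : x 0 = x₀ := by simp [hxdef, (hρpos hT).1]
  have hx2 (t : ℝ) : x t 2 = 0 := by simp [hxdef, h2]
  refine ⟨(T : EReal), x, by exact_mod_cast hT, hx0, hsol, ⟨fun t ht => ?_, fun t ht => ?_⟩,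
    fun _ t ht => hxne.2 (by exact_mod_cast ht.2), fun S hS => ?_, fun t _ ht => ?_, ?_,
    fun τ y hy0 hy => ?_, fun h => absurd h2 h⟩
  · exact (hd (by exact_mod_cast ht.2)).hasDerivWithinAt
  · have hne : t ≠ T := by exact_mod_cast ht.2
    refine ContinuousAt.continuousWithinAt ?_
    rcases hne.lt_or_gt with h | h
    · refine (continuousAt_const (y := (-γ / sigma x₀) • x₀)).congr_of_eventuallyEq ?_
      filter_upwards [Iio_mem_nhds h] with s hs
      exact hfl hs
    · refine (continuousAt_const (y := (0 : State))).congr_of_eventuallyEq ?_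
      filter_upwards [Ioi_mem_nhds h] with s hs
      exact hfr (le_of_lt hs)
  · obtain rfl : T = S := by exact_mod_cast hS
    refine ⟨?_, fun t ht => hxT ht⟩
    rw [← hxT (le_refl T)]
    exact hxc.continuousAt.mono_left nhdsWithin_le_nhds
  · exact ⟨fun h => ht ((eq_zero_iff _).2 ⟨h, hx2 t⟩), by simp [hx2, h2]⟩
  · refine (continuousOn_const (c := feedback γ v x₀)).congr fun t ht => ?_
    exact feedback_smul_of_plane h2 (hρpos (hxne.1 ht.2)).2
  · have hpre := isPreconnected_timeInterval τ
    have hyne {s t : ℝ} (ht : t ∈ timeInterval τ) (hs : s ∈ Icc 0 t) : y s ≠ 0 := fun h =>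
      hx (hy0 ▸ hy.eq_zero_iff hγ hv hpre (Icc_subset_timeInterval ht hs)
        (Icc_subset_timeInterval ht ⟨le_rfl, ht.1⟩) h)
    have heq : EqOn y x (timeInterval τ) := fun t ht => by
      have hsub := Icc_subset_timeInterval ht
      refine (hy.isTraj ht.1 hsub).eqOn_of_plane hγ ht.1 (hsol.isTraj le_rfl ht.1) (fun s hs => ?_)
        (fun s _ => hx2 s) (hy0.trans hx0.symm)
      have hsub' := (Icc_subset_Icc_right hs.2).trans hsub
      exact IsClassicalSolutionOn.vertical_eq_zero (v := v) hγ
        ⟨fun r hr => (hy.1 r (hsub' hr)).mono hsub', hy.2.mono hsub'⟩ hs.1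
        (fun r hr => hyne ht ⟨hr.1, hr.2.trans hs.2⟩) (by rw [hy0, h2])
    refine ⟨?_, heq⟩
    -- If `τ > T`, then `y` equals `x` at time `T` and so vanishes there, while a classical solution
    -- starting off the origin never does.
    by_contra! hlt
    have hmem : T ∈ timeInterval τ := ⟨hT.le, hlt⟩
    exact hyne hmem ⟨hT.le, le_rfl⟩ ((heq hmem).trans (hxT le_rfl))

theorem exists_isClassicalUntil (hγ : 0 < γ) (hv : ∀ s : ℝ, s ≠ 0 → ‖v s‖ = 1)
    (hx : x₀ ∉ exceptional) : ∃ t₀ x, IsClassicalUntil γ v x₀ t₀ x := by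
  by_cases h2 : x₀ 2 = 0
  · by_cases h0 : x₀ = 0
    · subst h0
      exact ⟨_, _, isClassicalUntil_zero hγ hv⟩
    · exact exists_isClassicalUntil_of_plane hγ hv h2 h0
  · exact exists_isClassicalUntil_of_regular hγ v (mem_regular_of_notMem_exceptional hx h2)

end Brockett

end

theorem mainTheorem4 (v : ℝ → Brockett.Control) (hv : ∀ s : ℝ, s ≠ 0 → ‖v s‖ = 1) :
    (∀ γ : ℝ, 0 < γ →
      -- size of the control
      Brockett.feedback γ v 0 = 0 ∧
      (∀ x : Brockett.State, x ≠ 0 → ‖Brockett.feedback γ v x‖ = γ) ∧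
      ∀ x₀ : Brockett.State, x₀ ∉ Brockett.exceptional →
        -- every absolutely continuous solution is driven to the origin
        (∀ y : ℝ → Brockett.State,
          Brockett.IsSolution (Brockett.closedLoop γ v) y → y 0 = x₀ →
            (∀ t : ℝ, 0 ≤ t → y t ∉ Brockett.exceptional) ∧
            (∃ R : ℝ, ∀ t : ℝ, 0 ≤ t → ‖y t‖ ≤ R) ∧
            Tendsto (fun t => Brockett.Q (y t)) atTop (𝓝 0) ∧
            Tendsto y atTop (𝓝 0)) ∧
        -- existence of a solution that is classical up to the time of reaching the origin
        ∃ (t₀ : EReal) (x : ℝ → Brockett.State),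
          0 < t₀ ∧ x 0 = x₀ ∧
          Brockett.IsSolution (Brockett.closedLoop γ v) x ∧
          Brockett.IsClassicalSolutionOn (Brockett.closedLoop γ v) x
            {t : ℝ | 0 ≤ t ∧ (t : EReal) ≠ t₀} ∧
          (x₀ ≠ 0 → ∀ t ∈ Brockett.timeInterval t₀, x t ≠ 0) ∧
          (∀ T : ℝ, t₀ = (T : EReal) →
            Tendsto x (𝓝[<] T) (𝓝 0) ∧ ∀ t : ℝ, T ≤ t → x t = 0) ∧
          -- along it the control does not switch and is continuous, away from the origin
          (∀ t : ℝ, 0 ≤ t → x t ≠ 0 →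
            Brockett.sigma (x t) ≠ 0 ∧ (x t 2 = 0 ↔ x₀ 2 = 0)) ∧
          ContinuousOn (fun t => Brockett.feedback γ v (x t)) {t : ℝ | 0 ≤ t ∧ x t ≠ 0} ∧
          -- it is the unique maximal classical solution
          (∀ (τ : EReal) (y : ℝ → Brockett.State), y 0 = x₀ →
            Brockett.IsClassicalSolutionOn (Brockett.closedLoop γ v) y
              (Brockett.timeInterval τ) →
            τ ≤ t₀ ∧ EqOn y x (Brockett.timeInterval τ)) ∧
          -- off the plane `x₃ = 0` it is the only absolutely continuous solution
          (x₀ 2 ≠ 0 → ∀ y : ℝ → Brockett.State,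
            Brockett.IsSolution (Brockett.closedLoop γ v) y → y 0 = x₀ →
            EqOn y x (Ici 0))) ∧
    -- arbitrarily small control
    (∀ ε : ℝ, 0 < ε → ∀ x : Brockett.State,
      Brockett.feedback (Real.sqrt ε) v x 0 ^ 2 + Brockett.feedback (Real.sqrt ε) v x 1 ^ 2 ≤ ε) := by
  refine ⟨fun γ hγ => ⟨Brockett.feedback_zero γ v, fun x hx => Brockett.norm_feedback hγ hv hx,
    fun x₀ hx₀ => ⟨fun y hy hy0 => ?_, ?_⟩⟩, fun ε hε x => Brockett.feedback_sq_le hv hε x⟩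
  · exact hy.attraction hγ hv (hy0 ▸ hx₀)
  · exact Brockett.exists_isClassicalUntil hγ hv hx₀
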